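/- All varieties are over $\mathbb C$. Let $d$ be an even positive integer, let $\Sigma_d$ be the Hirzebruch surface of degree $d$, let $\Delta_0$ be its section with $\Delta_0^2=-d$, and let $F$ be a fibre of the ruling $\Sigma_d\to\mathbb P^1$. Let $\Gamma_d\subset\Sigma_d$ be an irreducible curve with at worst simple (ADE) singularities and $\Gamma_d\sim 3(\Delta_0+dF)$. Let $\Delta\sim\Delta_0+dF$ be a section of the ruling such that $\Delta$ and $\Gamma_d$ are even tangential: every $P\in\Delta\cap\Gamma_d$ is a smooth point of both curves, and the intersection multiplicity $I_P(\Delta,\Gamma_d)$ is even. Up to isomorphism over $\Sigma_d$ there is exactly one double cover (a normal surface with a finite surjective morphism of degree $2$ to $\Sigma_d$) with branch locus $\Delta_0+\Gamma_d$, and exactly one with branch locus $\Delta_0+\Delta$. Let $S_d\to\Sigma_d$ be the canonical resolution of the former. The ruling induces an elliptic fibration $S_d\to\mathbb P^1$; its generic fibre is the curve $y^2=u^3+c_1(t)u^2+c_2(t)u+c_3(t)$ over $\mathbb C(t)$, where the right-hand side is the affine equation of $\Gamma_d$, made monic in $u$, in coordinates $(t,u)$ in which $t$ is the coordinate of $\mathbb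 P^1$ and $\Delta_0$ is $u=\infty$. Let $\mathrm{MW}(S_d)$ be its group of sections, the zero element being the section $O$ over $\Delta_0$. Let $((\Delta_0+\Delta)/\Gamma_d)$ be $1$ if $\Gamma_d$ is a splitting curve with respect to the double cover $q$ with branch locus $\Delta_0+\Delta$, and $-1$ otherwise; here $\Gamma_d$ is a splitting curve if $q^*\Gamma_d=\Gamma^++\Gamma^-$ with distinct prime divisors $\Gamma^+,\Gamma^-$ that are exchanged by the covering involution of $q$. For $s\in\mathrm{MW}(S_d)$ put $\varepsilon(s)=0$ if $s=2s_o$ for some $s_o\in\mathrm{MW}(S_d)$, and $\varepsilon(s)=1$ otherwise. Then exactly two sections in $\mathrm{MW}(S_d)$ lie over $\Delta$. Call them $s_\Delta^+\neq s_\Delta^-$; they satisfy $s_\Delta^+=-s_\Delta^-$, $\varepsilon(s_\Delta^+)=\varepsilon(s_\Delta^-)$ and $$\left(\frac{\Delta_0+\Delta}{\Gamma_d}\right)=(-1)^{\varepsilon(s_\Delta^+)}.$$ -/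

import Mathlib

open Polynomial

noncomputable section

namespace Hirzebruch

/-! ## The Hirzebruch surface in homogeneous coordinates

The Hirzebruch surface `Σ_d` is the toric surface with homogeneous coordinates `(s, t, u, v)`,
`(s, t) ≠ (0, 0)`, `(u, v) ≠ (0, 0)`, modulo the action of `ℂˣ × ℂˣ` given by
`(λ, μ) • (s, t, u, v) = (λ s, λ t, λ ^ d μ u, μ v)`.  The ruling is `(s, t, u, v) ↦ [s : t]`, and the
section with self-intersection `-d` is `v = 0`. -/

/-- The homogeneous coordinate ring `ℂ[s, t, u, v]`
(`s`, `t`, `u`, `v` are `X 0`, `X 1`, `X 2`, `X 3`). -/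
abbrev Cox : Type := MvPolynomial (Fin 4) ℂ

/-- The divisor classes of the coordinates of `Σ_d`. The pair `(m, n)` is the class of
`m F + n Δ₀`, where `F` is a fibre of the ruling and `Δ₀` is the curve `v = 0`; these two classes
form a basis of the divisor class group. -/
def weight (d : ℕ) : Fin 4 → ℕ × ℕ := ![(1, 0), (1, 0), (d, 1), (0, 1)]

/-- `a` is homogeneous of class `n`, that is, a section of the line bundle of class `n`. -/
abbrev IsHomog (d : ℕ) (a : Cox) (n : ℕ × ℕ) : Prop :=
  MvPolynomial.IsWeightedHomogeneous (weight d) a n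

/-- An irreducible curve on `Σ_d`, given by an irreducible homogeneous equation, together with its
linear equivalence class. -/
structure Curve (d : ℕ) where
  /-- the equation -/
  eqn : Cox
  /-- the class; `(m, n)` stands for `m F + n Δ₀` -/
  cls : ℕ × ℕ
  irreducible : Irreducible eqn
  homogeneous : IsHomog d eqn cls

/-- The section `Δ₀` with self-intersection number `-d`. -/
def negSection (d : ℕ) : Curve d where
  eqn := MvPolynomial.X 3
  cls := (0, 1)
  irreducible := MvPolynomial.X_prime.irreducible
  homogeneous := MvPolynomial.isWeightedHomogeneous_X ℂ (weight d) 3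

/-- The class of a fibre of the ruling. -/
def fibreClass : ℕ × ℕ := (1, 0)

/-- A curve is a section of the ruling if it is irreducible and its intersection number with a
fibre, which for the class `m F + n Δ₀` is `n`, is equal to `1`. -/
def Curve.IsSection {d : ℕ} (C : Curve d) : Prop := C.cls.2 = 1

/-- Homogeneous coordinates of a point of `Σ_d`. (Everything below that depends on a point is
invariant under the torus action.) -/
structure Pt where
  coord : Fin 4 → ℂ
  base_ne : coord 0 ≠ 0 ∨ coord 1 ≠ 0
  fibre_ne : coord 2 ≠ 0 ∨ coord 3 ≠ 0

/-- The points of a curve. -/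
def Curve.points {d : ℕ} (C : Curve d) : Set Pt := {p | MvPolynomial.eval p.coord C.eqn = 0}

/-- The curve `C` is smooth at its point `p` (Jacobian criterion; the quotient by the torus is
locally trivial, so that it can be checked in homogeneous coordinates). -/
def Curve.IsSmoothAt {d : ℕ} (C : Curve d) (p : Pt) : Prop :=
  ∃ i, MvPolynomial.eval p.coord (MvPolynomial.pderiv i C.eqn) ≠ 0

/-! ## Function field and local rings -/

/-- The function field `ℂ(t, u)` of `Σ_d`, where `t`, `u` are the affine coordinates on the chart
`s = v = 1`. -/
abbrev FunField : Type := FractionRing (MvPolynomial (Fin 2) ℂ)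

/-- the function `t` -/
def tFun : FunField := algebraMap (MvPolynomial (Fin 2) ℂ) FunField (MvPolynomial.X 0)

/-- the function `u` -/
def uFun : FunField := algebraMap (MvPolynomial (Fin 2) ℂ) FunField (MvPolynomial.X 1)

/-- Dehomogenization `s = v = 1`. A quotient `a / b` of homogeneous elements of the same class is
the rational function `dehom a / dehom b`. -/
def dehom : Cox →ₐ[ℂ] FunField := MvPolynomial.aeval ![1, tFun, uFun, 1]

/-- The ring of the rational functions `a / b` on `Σ_d`, with `a`, `b` homogeneous of the same class
and `b ∉ 𝔭`. -/
def localRing (d : ℕ) (𝔭 : Ideal Cox) [h𝔭 : 𝔭.IsPrime] : Subalgebra ℂ FunField where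
  carrier := {z | ∃ (n : ℕ × ℕ) (a b : Cox), IsHomog d a n ∧ IsHomog d b n ∧ b ∉ 𝔭 ∧
    z * dehom b = dehom a}
  mul_mem' := by
    rintro z z' ⟨n, a, b, ha, hb, hb', hz⟩ ⟨n', a', b', ha', hb1, hb1', hz'⟩
    refine ⟨n + n', a * a', b * b', ha.mul ha', hb.mul hb1, fun h => ?_, ?_⟩
    · exact (h𝔭.mem_or_mem h).elim hb' hb1'
    · rw [map_mul, map_mul, ← hz, ← hz']; ring
  add_mem' := by
    rintro z z' ⟨n, a, b, ha, hb, hb', hz⟩ ⟨n', a', b', ha', hb1, hb1', hz'⟩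
    refine ⟨n + n', a * b' + b * a', b * b', (ha.mul hb1).add (hb.mul ha'), hb.mul hb1,
      fun h => ?_, ?_⟩
    · exact (h𝔭.mem_or_mem h).elim hb' hb1'
    · rw [map_mul, map_add, map_mul, map_mul, ← hz, ← hz']; ring
  algebraMap_mem' r :=
    ⟨0, MvPolynomial.C r, 1, MvPolynomial.isWeightedHomogeneous_C _ r,
      MvPolynomial.isWeightedHomogeneous_one ℂ _, fun h => h𝔭.ne_top ((Ideal.eq_top_iff_one _).2 h),
      by rw [map_one, mul_one, ← MvPolynomial.algebraMap_eq, AlgHom.commutes]⟩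

/-- The ideal of the curve `C` in such a ring: the `a / b` with `a` divisible by the equation. -/
def Curve.ideal {d : ℕ} (C : Curve d) (𝔭 : Ideal Cox) [h𝔭 : 𝔭.IsPrime] :
    Ideal (localRing d 𝔭) where
  carrier := {z | ∃ (n : ℕ × ℕ) (a b : Cox), IsHomog d a n ∧ IsHomog d b n ∧ b ∉ 𝔭 ∧
    C.eqn ∣ a ∧ (z : FunField) * dehom b = dehom a}
  add_mem' := by
    rintro z z' ⟨n, a, b, ha, hb, hb', hC, hz⟩ ⟨n', a', b', ha', hb1, hb1', hC', hz'⟩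
    refine ⟨n + n', a * b' + b * a', b * b', (ha.mul hb1).add (hb.mul ha'), hb.mul hb1,
      fun h => ?_, dvd_add (hC.mul_right _) (hC'.mul_left _), ?_⟩
    · exact (h𝔭.mem_or_mem h).elim hb' hb1'
    · rw [map_mul, map_add, map_mul, map_mul, ← hz, ← hz', Subalgebra.coe_add]; ring
  zero_mem' := ⟨0, 0, 1, MvPolynomial.isWeightedHomogeneous_zero ℂ _ _,
    MvPolynomial.isWeightedHomogeneous_one ℂ _, fun h => h𝔭.ne_top ((Ideal.eq_top_iff_one _).2 h),
    dvd_zero _, by simp⟩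
  smul_mem' := by
    rintro c z ⟨n, a, b, ha, hb, hb', hC, hz⟩
    obtain ⟨n', a', b', ha', hb1, hb1', hc⟩ := c.2
    refine ⟨n' + n, a' * a, b' * b, ha'.mul ha, hb1.mul hb, fun h => ?_, hC.mul_left _, ?_⟩
    · exact (h𝔭.mem_or_mem h).elim hb1' hb'
    · rw [map_mul, map_mul, ← hz, ← hc, smul_eq_mul, Subalgebra.coe_mul]; ring

/-- The polynomials vanishing at the coordinates of a point. -/
def Pt.prime (p : Pt) : Ideal Cox := RingHom.ker (MvPolynomial.eval p.coord)

instance Pt.prime_isPrime (p : Pt) : p.prime.IsPrime := RingHom.ker_isPrime _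

/-- The local ring of `Σ_d` at a point. -/
abbrev Pt.localRing (d : ℕ) (p : Pt) : Subalgebra ℂ FunField := Hirzebruch.localRing d p.prime

/-- The homogeneous prime ideal of a curve. -/
def Curve.prime {d : ℕ} (C : Curve d) : Ideal Cox := Ideal.span {C.eqn}

instance Curve.prime_isPrime {d : ℕ} (C : Curve d) : C.prime.IsPrime :=
  (Ideal.span_singleton_prime C.irreducible.ne_zero).2 C.irreducible.prime

/-- The local ring of `Σ_d` at the generic point of a curve (a discrete valuation ring, with
maximal ideal `C.ideal C.prime`). -/
abbrev Curve.localRing {d : ℕ} (C : Curve d) : Subalgebra ℂ FunField :=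
  Hirzebruch.localRing d C.prime

/-! ## Even tangential curves and simple singularities -/

/-- The intersection multiplicity of two curves at a point. -/
def intersectionMult {d : ℕ} (C D : Curve d) (p : Pt) : ℕ :=
  Module.finrank ℂ (p.localRing d ⧸ (C.ideal p.prime ⊔ D.ideal p.prime))

/-- Even tangential irreducible curves: they are distinct, every common point is a smooth
point of both, and all intersection multiplicities are even. -/
def EvenTangential {d : ℕ} (C D : Curve d) : Prop :=
  ¬ Associated C.eqn D.eqn ∧
    ∀ p ∈ C.points ∩ D.points, C.IsSmoothAt p ∧ D.IsSmoothAt p ∧ Even (intersectionMult C D p)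

/-- The normal forms of the simple (ADE) plane curve singularities. -/
inductive IsADE : MvPowerSeries (Fin 2) ℂ → Prop
  | A (n : ℕ) (hn : 1 ≤ n) :
      IsADE (MvPowerSeries.X 0 ^ 2 + MvPowerSeries.X 1 ^ (n + 1))
  | D (n : ℕ) (hn : 4 ≤ n) :
      IsADE (MvPowerSeries.X 1 * (MvPowerSeries.X 0 ^ 2 + MvPowerSeries.X 1 ^ (n - 2)))
  | E6 : IsADE (MvPowerSeries.X 0 ^ 3 + MvPowerSeries.X 1 ^ 4)
  | E7 : IsADE (MvPowerSeries.X 0 * (MvPowerSeries.X 0 ^ 2 + MvPowerSeries.X 1 ^ 3))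
  | E8 : IsADE (MvPowerSeries.X 0 ^ 3 + MvPowerSeries.X 1 ^ 5)

/-- A ring homomorphism from the local ring at `p` to `ℂ⟦x, y⟧` is a formal coordinate system
at `p` (induces an isomorphism of the completion with `ℂ⟦x, y⟧`) if some two regular functions
have the linear parts `x` and `y`. -/
def IsFormalCoordinates {d : ℕ} {p : Pt}
    (ψ : p.localRing d →ₐ[ℂ] MvPowerSeries (Fin 2) ℂ) : Prop :=
  ∃ z : Fin 2 → p.localRing d, ∀ i j,
    MvPowerSeries.coeff (Finsupp.single j 1) (ψ (z i)) = if i = j then 1 else 0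

/-- The curve `C` has a simple singularity at `p`. -/
def Curve.HasSimpleSingularityAt {d : ℕ} (C : Curve d) (p : Pt) : Prop :=
  ∃ ψ : p.localRing d →ₐ[ℂ] MvPowerSeries (Fin 2) ℂ, IsFormalCoordinates ψ ∧
    ∃ g, IsADE g ∧ (C.ideal p.prime).map ψ = Ideal.span {g}

/-- The curve `C` has at worst simple singularities. -/
def Curve.AtWorstSimpleSingularities {d : ℕ} (C : Curve d) : Prop :=
  ∀ p ∈ C.points, C.IsSmoothAt p ∨ C.HasSimpleSingularityAt p

/-! ## Double covers

A double cover `f : Z' → Σ_d` by a normal surface `Z'` is the normalization of `Σ_d` in the quadratic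
extension `ℂ(Z')` of its function field, so that it is the same as such an extension: over a local
ring `R` of `Σ_d`, `Z'` is the spectrum of the integral closure of `R` in `ℂ(Z')`. -/

/-- A double cover of `Σ_d`. -/
structure DoubleCover where
  /-- the function field of the covering surface -/
  field : Type
  [isField : Field field]
  [isAlgebra : Algebra FunField field]
  finrank_eq : Module.finrank FunField field = 2

attribute [instance] DoubleCover.isField DoubleCover.isAlgebra

/-- Two double covers are isomorphic over `Σ_d`. -/
def DoubleCover.Iso (Z Z' : DoubleCover) : Prop := Nonempty (Z.field ≃ₐ[FunField] Z'.field)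

/-- The points of the covering surface over the point `p`. -/
abbrev DoubleCover.fibre (Z : DoubleCover) (d : ℕ) (p : Pt) : Type :=
  MaximalSpectrum (integralClosure (p.localRing d) Z.field)

/-- The branch locus: the points over which the cover is not locally an isomorphism, that is, does
not have two distinct inverse images. -/
def DoubleCover.branchLocus (Z : DoubleCover) (d : ℕ) : Set Pt :=
  {p | Nat.card (Z.fibre d p) ≠ 2}

/-- The curve `D` is a splitting curve with respect to the double cover: its pull-back is the sum
of two distinct prime divisors exchanged by the covering involution `σ`. (Divisors supported over
`D` are ideals in the integral closure of the local ring of `Σ_d` at `D`; exceptional curves of a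
resolution of the covering surface do not occur there.) -/
def DoubleCover.IsSplitting {d : ℕ} (Z : DoubleCover) (D : Curve d) : Prop :=
  ∃ (P Q : Ideal (integralClosure D.localRing Z.field)) (σ : Z.field ≃ₐ[FunField] Z.field),
    P.IsPrime ∧ Q.IsPrime ∧ P ≠ Q ∧ σ ≠ 1 ∧
    (∀ x y : integralClosure D.localRing Z.field,
      (y : Z.field) = σ (x : Z.field) → (x ∈ P ↔ y ∈ Q)) ∧
    (D.ideal D.prime).map (algebraMap D.localRing (integralClosure D.localRing Z.field)) = P * Q

/-- Up to isomorphism there is exactly one double cover of `Σ_d` with branch locus `B`. -/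
def HasUniqueDoubleCover (d : ℕ) (B : Set Pt) : Prop :=
  ∃ Z : DoubleCover, Z.branchLocus d = B ∧
    ∀ Z' : DoubleCover, Z'.branchLocus d = B → Z.Iso Z'

/-- `B` is a quadratic residue curve mod `D`: the double cover with branch locus `B` is determined
by `B`, and `D` is a splitting curve with respect to it. -/
def IsQuadraticResidue {d : ℕ} (B : Set Pt) (D : Curve d) : Prop :=
  ∃ Z : DoubleCover, Z.branchLocus d = B ∧
    (∀ Z' : DoubleCover, Z'.branchLocus d = B → Z.Iso Z') ∧ Z.IsSplitting D

open Classical in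
/-- The symbol `(B / D)`. -/
def residueSymbol {d : ℕ} (B : Set Pt) (D : Curve d) : ℤ :=
  if IsQuadraticResidue B D then 1 else -1

/-! ## The elliptic surface and its Mordell-Weil group -/

/-- The affine equation in `ℂ[t][u]`, in the chart `s = v = 1`, of a curve on `Σ_d`. -/
def Curve.affineEqn {d : ℕ} (C : Curve d) : ℂ[X][X] :=
  MvPolynomial.aeval ![1, Polynomial.C Polynomial.X, Polynomial.X, 1] C.eqn

/-- The coefficient of `u ^ k` in the affine equation, scaled so that `u ^ 3` has coefficient `1`
(for a curve of class `3 (Δ₀ + d F)`, the coefficient of `u ^ 3` is a non-zero constant). -/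
def Curve.monicCoeff {d : ℕ} (C : Curve d) (k : ℕ) : RatFunc ℂ :=
  algebraMap ℂ[X] (RatFunc ℂ) (C.affineEqn.coeff k) /
    algebraMap ℂ[X] (RatFunc ℂ) (C.affineEqn.coeff 3)

/-- For a curve `Γ` of class `3 (Δ₀ + d F)`: the generic fibre
`y² = u³ + c₁(t) u² + c₂(t) u + c₃(t)`, over `ℂ(t) = ℂ(ℙ¹)`, of the elliptic surface `S_d → ℙ¹`, where `S_d`
is the resolution of the double cover of `Σ_d` branched along `Δ₀ + Γ`, and the right hand side is
the equation of `Γ`. The curve over `Δ₀` is the point at infinity. -/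
def genericFibre {d : ℕ} (Γ : Curve d) : WeierstrassCurve (RatFunc ℂ) where
  a₁ := 0
  a₂ := Γ.monicCoeff 2
  a₃ := 0
  a₄ := Γ.monicCoeff 1
  a₆ := Γ.monicCoeff 0

/-- The Mordell-Weil group of `S_d`, with the section `O` over `Δ₀` as zero: the sections of
`S_d → ℙ¹` are the `ℂ(t)`-rational points of the generic fibre. -/
abbrev MW {d : ℕ} (Γ : Curve d) : Type := (genericFibre Γ).toAffine.Point

open Classical in
instance MW.addCommGroup {d : ℕ} (Γ : Curve d) : AddCommGroup (MW Γ) := inferInstance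

/-- The sections of `S_d → ℙ¹` whose image in `Σ_d` is the curve `C`, where `C ≠ Δ₀`. -/
def sectionsOver {d : ℕ} (Γ C : Curve d) : Set (MW Γ) :=
  {s | ∃ (x y : RatFunc ℂ) (h : (genericFibre Γ).toAffine.Nonsingular x y),
    s = .some x y h ∧ MvPolynomial.aeval ![1, RatFunc.X, x, 1] C.eqn = 0}

open Classical in
/-- `ε(s)` is `0` if `s` is divisible by `2` in the Mordell-Weil group, and `1` otherwise. -/
def eps {d : ℕ} {Γ : Curve d} (s : MW Γ) : ℕ := if ∃ s₀ : MW Γ, s = 2 • s₀ then 0 else 1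

lemma tFun_transcendental : Function.Injective (Polynomial.aeval (R := ℂ) tFun) := by
  have h : Transcendental ℂ (MvPolynomial.X 0 : MvPolynomial (Fin 2) ℂ) :=
    MvPolynomial.transcendental_X ℂ 0
  have h' : Transcendental ℂ tFun :=
    (transcendental_algebraMap_iff (IsFractionRing.injective _ FunField)).2 h
  exact transcendental_iff_injective.1 h'

/-- The inclusion `ℂ(t) → ℂ(t, u)` given by the ruling. -/
def ruling : RatFunc ℂ →ₐ[ℂ] FunField :=
  RatFunc.liftAlgHom (Polynomial.aeval tFun)
    (nonZeroDivisors_le_comap_nonZeroDivisors_of_injective _ tFun_transcendental)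

/-- `W` is the generic fibre of the composite of the double cover with the ruling: the function
field of the covering surface is generated over that of `Σ_d` by a function `η` such that
`(u, η)` satisfies the equation of `W`. -/
def DoubleCover.HasGenericFibre (Z : DoubleCover) (W : WeierstrassCurve (RatFunc ℂ)) : Prop :=
  ∃ η : Z.field,
    (W.map ((algebraMap FunField Z.field).comp ruling.toRingHom)).toAffine.Equation
      (algebraMap FunField Z.field uFun) η ∧
    IntermediateField.adjoin FunField {η} = ⊤

end Hirzebruch

end

/-!
The theorem is a comparison of two criteria, each saying that one and the same function is a square in
the function field of `Γ`.

*Double covers.* A double cover of `Σ_d` is a quadratic extension of `ℂ(t, u)`, and the homogeneous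
coordinate ring of `Σ_d` is factorial, so that the extension is generated by the square root of a
squarefree homogeneous equation `H` of even class (`DoubleCover.exists_isSqrtOf`). Over a local ring `R`
of `Σ_d` with a local equation `h` of `H`, the covering surface is `R + R √h`, since `R` is integrally
closed and `h` is squarefree in `R` (`isSquarefreeRoot`). The fibre over a point therefore has two
elements where `H ≠ 0` and one where `H = 0`: the branch locus is the zero set of `H`
(`DoubleCover.IsSqrtOf.branchLocus_eq`), and by the Nullstellensatz it determines `H` up to a constant
(`dvd_of_zeros_subset`). This gives existence and uniqueness of the covers with branch loci `Δ₀ + Γ` and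
`Δ₀ + Δ`, whose classes are even because `d` is. For `Δ₀ + Γ` the extension is generated by the square
root of the affine equation of `Γ`, which is the generic fibre of `S_d`.

*Splitting.* If `Δ` is `u = x(t)`, then the cover branched along `Δ₀ + Δ` is given by `√(u - x)`. The
curve `Γ` is not contained in the branch locus, hence it splits or is inert according to whether
`u - x` is a square in the residue field `ℂ(t)[u] / (f)` of `Σ_d` along `Γ`, where `f` is the
equation of `Γ` (`isSplitting_iff_exists_dvd`, `exists_dvd_iff_exists_map_dvd`).

*Sections.* The intersection multiplicity of `Δ` and `Γ` at a point over `t = τ` is the order of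
vanishing of `f(t, x(t))` at `τ` (`intersectionMult_graphPt`). These orders are even, so that
`f(t, x(t)) = y(t)²` is a square, and the sections over `Δ` are `(x, y)` and `(x, -y)`. As `f` is
irreducible over `ℂ(t)`, two-descent shows that they are divisible by `2` in the Mordell-Weil group if
and only if `x - u` is a square in `ℂ(t)[u] / (f)`
(`WeierstrassCurve.Affine.exists_eq_two_nsmul_iff`). Since `-1` is a square, this is the criterion for
`Γ` to split.
-/

noncomputable section

namespace Hirzebruch

/-! ### Weighted homogeneous factors -/

section Scale

variable {σ R : Type*} [CommRing R]

/-- The action of the one-parameter group with weights `w`: the variable `X i` is multiplied by the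
`w i`-th power of a new variable. -/
def scaleHom (w : σ → ℕ) : MvPolynomial σ R →ₐ[R] (MvPolynomial σ R)[X] :=
  MvPolynomial.aeval fun i => C (MvPolynomial.X i) * X ^ w i

lemma coeff_scaleHom (w : σ → ℕ) (a : MvPolynomial σ R) (k : ℕ) :
    (scaleHom w a).coeff k = MvPolynomial.weightedHomogeneousComponent w k a := by
  induction a using MvPolynomial.induction_on' with
  | monomial m r =>
    have h : scaleHom w (MvPolynomial.monomial m r) =
        C (MvPolynomial.monomial m r) * X ^ (Finsupp.weight w m) := by
      rw [scaleHom, MvPolynomial.aeval_monomial, MvPolynomial.monomial_eq, C.map_mul, mul_assoc]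
      congr 1
      simp only [Finsupp.prod, mul_pow, Finset.prod_mul_distrib, map_prod, map_pow,
        Finsupp.weight_apply, Finsupp.sum, ← Finset.prod_pow_eq_pow_sum, smul_eq_mul, ← pow_mul]
      simp only [mul_comm]
    classical
    rw [h, coeff_C_mul, coeff_X_pow]
    ext n
    rw [MvPolynomial.coeff_weightedHomogeneousComponent, MvPolynomial.coeff_monomial]
    by_cases h1 : m = n
    · subst h1; by_cases h2 : k = Finsupp.weight w m <;> simp [h2, eq_comm]
    · by_cases h2 : k = Finsupp.weight w m <;> simp [h1, h2]
  | add p q hp hq => rw [map_add, coeff_add, hp, hq, map_add]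

/-- A factor of a non-zero weighted homogeneous polynomial is weighted homogeneous: the image of the
product under `scaleHom` is a monomial, and a factor of a monomial has equal lowest and highest
degree. -/
lemma isWeightedHomogeneous_of_mul [IsDomain R] {w : σ → ℕ} {a b : MvPolynomial σ R} {n : ℕ}
    (h : MvPolynomial.IsWeightedHomogeneous w (a * b) n) (hab : a * b ≠ 0) :
    ∃ k, MvPolynomial.IsWeightedHomogeneous w a k := by
  classical
  have key : ∀ c : MvPolynomial σ R, ∀ m, c.coeff m ≠ 0 →
      (scaleHom w c).coeff (Finsupp.weight w m) ≠ 0 := by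
    intro c m hm h0
    apply hm
    have := congrArg (MvPolynomial.coeff m) h0
    rwa [coeff_scaleHom, MvPolynomial.coeff_weightedHomogeneousComponent, if_pos rfl] at this
  have hne : ∀ c : MvPolynomial σ R, c ≠ 0 → scaleHom w c ≠ 0 := by
    intro c hc h0
    obtain ⟨m, hm⟩ := MvPolynomial.ne_zero_iff.1 hc
    exact key c m hm (by rw [h0, coeff_zero])
  have hmon : scaleHom w (a * b) = monomial n (a * b) := by
    ext1 k
    rw [coeff_scaleHom, coeff_monomial]
    split_ifs with hk
    · subst hk; exact h.weightedHomogeneousComponent_same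
    · exact h.weightedHomogeneousComponent_ne _ (Ne.symm hk)
  have ha := hne a (left_ne_zero_of_mul hab)
  have hb := hne b (right_ne_zero_of_mul hab)
  have h1 := natDegree_mul ha hb
  have h2 := natTrailingDegree_mul ha hb
  rw [← map_mul, hmon, natDegree_monomial, if_neg hab] at h1
  rw [← map_mul, hmon, natTrailingDegree_monomial hab] at h2
  have h3 := natTrailingDegree_le_natDegree (scaleHom w a)
  have h4 := natTrailingDegree_le_natDegree (scaleHom w b)
  refine ⟨(scaleHom w a).natDegree, fun m hm => ?_⟩
  have h5 := le_natDegree_of_ne_zero (key a m hm)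
  have h6 := natTrailingDegree_le_of_ne_zero (key a m hm)
  omega

end Scale

lemma weight_eq (d : ℕ) (m : Fin 4 →₀ ℕ) :
    Finsupp.weight (weight d) m = (m 0 + m 1 + d * m 2, m 2 + m 3) := by
  rw [Finsupp.weight_eq_sum]
  ext <;> simp [Fin.sum_univ_four, weight, mul_comm]

/-- Homogeneity for classes in `ℕ × ℕ` is homogeneity for two gradings by `ℕ`. -/
lemma isHomog_iff {d : ℕ} {a : Cox} {n : ℕ × ℕ} :
    IsHomog d a n ↔ MvPolynomial.IsWeightedHomogeneous (fun i => (weight d i).1) a n.1 ∧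
      MvPolynomial.IsWeightedHomogeneous (fun i => (weight d i).2) a n.2 := by
  have h1 : ∀ m : Fin 4 →₀ ℕ, Finsupp.weight (fun i => (weight d i).1) m =
      (Finsupp.weight (weight d) m).1 := by
    intro m; simp [Finsupp.weight_eq_sum, Fin.sum_univ_four]
  have h2 : ∀ m : Fin 4 →₀ ℕ, Finsupp.weight (fun i => (weight d i).2) m =
      (Finsupp.weight (weight d) m).2 := by
    intro m; simp [Finsupp.weight_eq_sum, Fin.sum_univ_four]
  simp only [IsHomog, MvPolynomial.IsWeightedHomogeneous, h1, h2, Prod.ext_iff]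
  exact ⟨fun h => ⟨fun m hm => (h hm).1, fun m hm => (h hm).2⟩, fun h m hm => ⟨h.1 hm, h.2 hm⟩⟩

/-- A factor of a non-zero homogeneous element is homogeneous. -/
lemma IsHomog.of_mul {d : ℕ} {a b : Cox} {n : ℕ × ℕ} (h : IsHomog d (a * b) n)
    (hab : a * b ≠ 0) : ∃ k l, IsHomog d a k ∧ IsHomog d b l ∧ k + l = n := by
  have aux : ∀ {a b : Cox}, IsHomog d (a * b) n → a * b ≠ 0 → ∃ k, IsHomog d a k := by
    intro a b h hab
    rw [isHomog_iff] at h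
    obtain ⟨k, hk⟩ := isWeightedHomogeneous_of_mul h.1 hab
    obtain ⟨l, hl⟩ := isWeightedHomogeneous_of_mul h.2 hab
    exact ⟨(k, l), isHomog_iff.2 ⟨hk, hl⟩⟩
  obtain ⟨k, hk⟩ := aux h hab
  rw [mul_comm] at h hab
  obtain ⟨l, hl⟩ := aux h hab
  exact ⟨k, l, hk, hl, by rw [add_comm]; exact (hl.mul hk).inj_right hab h⟩

lemma isHomog_X (d : ℕ) (i : Fin 4) : IsHomog d (MvPolynomial.X i) (weight d i) :=
  MvPolynomial.isWeightedHomogeneous_X ℂ (weight d) i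

/-! ### The affine chart -/

/-- The restriction of homogeneous equations to the chart `s = v = 1`, with values in `ℂ[t][u]`. -/
def affine : Cox →ₐ[ℂ] ℂ[X][X] := MvPolynomial.aeval ![1, C X, X, 1]

/-- The inclusion `ℂ[t][u] → ℂ(t, u)`. -/
def toFunField : ℂ[X][X] →ₐ[ℂ] FunField :=
  Polynomial.eval₂AlgHom (aeval tFun) uFun fun _ => Commute.all _ _

@[simp] lemma toFunField_C (p : ℂ[X]) : toFunField (C p) = aeval tFun p := by
  simp [toFunField]

@[simp] lemma toFunField_X : toFunField X = uFun := by
  simp [toFunField]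

@[simp] lemma affine_X_zero : affine (MvPolynomial.X 0) = 1 := by simp [affine]
@[simp] lemma affine_X_one : affine (MvPolynomial.X 1) = C X := by simp [affine]
@[simp] lemma affine_X_two : affine (MvPolynomial.X 2) = X := by simp [affine]
@[simp] lemma affine_X_three : affine (MvPolynomial.X 3) = 1 := by simp [affine]

lemma dehom_eq (a : Cox) : dehom a = toFunField (affine a) := by
  have : dehom = toFunField.comp affine := by
    apply MvPolynomial.algHom_ext
    intro i
    fin_cases i <;> simp [dehom]
  rw [this]; rfl

lemma algebraMap_eq_toFunField (p : MvPolynomial (Fin 2) ℂ) :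
    algebraMap _ FunField p = toFunField (MvPolynomial.aeval ![C X, X] p) := by
  have : Algebra.algHom ℂ (MvPolynomial (Fin 2) ℂ) FunField =
      toFunField.comp (MvPolynomial.aeval ![C X, X]) := by
    apply MvPolynomial.algHom_ext
    intro i
    fin_cases i <;> simp [tFun, uFun, Algebra.algHom]
  exact congrArg (fun f : MvPolynomial (Fin 2) ℂ →ₐ[ℂ] FunField => f p) this

lemma toFunField_injective : Function.Injective toFunField := by
  let j : ℂ[X][X] →ₐ[ℂ] MvPolynomial (Fin 2) ℂ :=
    Polynomial.eval₂AlgHom (aeval (MvPolynomial.X 0)) (MvPolynomial.X 1) fun _ => Commute.all _ _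
  have h1 : ∀ p, MvPolynomial.aeval (![C X, X] : Fin 2 → ℂ[X][X]) (j p) = p := by
    have : (MvPolynomial.aeval (![C X, X] : Fin 2 → ℂ[X][X])).comp j = AlgHom.id ℂ _ := by
      apply Polynomial.algHom_ext'
      · apply Polynomial.algHom_ext
        simp [j]
      · simp [j]
    exact fun p => congrArg (fun f : ℂ[X][X] →ₐ[ℂ] ℂ[X][X] => f p) this
  have h2 : ∀ p, toFunField p = algebraMap _ FunField (j p) := fun p => by
    rw [algebraMap_eq_toFunField, h1]
  intro p q hpq
  rw [h2, h2] at hpq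
  rw [← h1 p, ← h1 q, IsFractionRing.injective _ _ hpq]

lemma exists_toFunField_div (z : FunField) :
    ∃ a b : ℂ[X][X], b ≠ 0 ∧ z * toFunField b = toFunField a := by
  obtain ⟨a, b, hb, rfl⟩ := IsFractionRing.div_surjective (A := MvPolynomial (Fin 2) ℂ) z
  have hb' : algebraMap (MvPolynomial (Fin 2) ℂ) FunField b ≠ 0 := by
    simpa using nonZeroDivisors.ne_zero hb
  refine ⟨MvPolynomial.aeval ![C X, X] a, MvPolynomial.aeval ![C X, X] b, fun h0 => ?_, ?_⟩
  · exact hb' (by rw [algebraMap_eq_toFunField, h0, map_zero])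
  · rw [← algebraMap_eq_toFunField, ← algebraMap_eq_toFunField, div_mul_cancel₀ _ hb']

lemma affine_monomial (m : Fin 4 →₀ ℕ) (r : ℂ) :
    affine (MvPolynomial.monomial m r) = C (C r * X ^ m 1) * X ^ m 2 := by
  rw [affine, MvPolynomial.aeval_monomial, Finsupp.prod_fintype _ _ (by simp)]
  simp [Fin.prod_univ_four, mul_assoc]

/-- On homogeneous elements of a given class, the passage to the chart `s = v = 1` only forgets
the exponents of `s` and `v`, which are determined by those of `t` and `u`. -/
lemma coeff_coeff_affine {d : ℕ} {a : Cox} {n : ℕ × ℕ} (h : IsHomog d a n) (m : Fin 4 →₀ ℕ)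
    (hm : Finsupp.weight (weight d) m = n) :
    ((affine a).coeff (m 2)).coeff (m 1) = a.coeff m := by
  conv_lhs => rw [a.as_sum]
  simp only [map_sum, affine_monomial, finsetSum_coeff, coeff_C_mul, coeff_X_pow, mul_ite,
    mul_one, mul_zero]
  rw [Finset.sum_eq_single m]
  · simp
  · intro m' hm' hne
    have := h (MvPolynomial.mem_support_iff.1 hm')
    rw [← hm, weight_eq, weight_eq, Prod.ext_iff] at this
    obtain ⟨h1, h2⟩ := this
    simp only at h1 h2
    by_cases e2 : m 2 = m' 2
    · rw [if_pos e2]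
      by_cases e1 : m 1 = m' 1
      · exfalso; apply hne
        rw [e1, e2] at h1
        rw [e2] at h2
        ext i; fin_cases i <;> simp <;> omega
      · simp [e1]
    · simp [e2]
  · intro h0
    simp [MvPolynomial.notMem_support_iff.1 h0]

lemma coeff_coeff_affine_ne_zero {d : ℕ} {a : Cox} {n : ℕ × ℕ} (h : IsHomog d a n) {j k : ℕ}
    (hjk : ((affine a).coeff k).coeff j ≠ 0) : j + d * k ≤ n.1 ∧ k ≤ n.2 := by
  by_contra hcon
  apply hjk
  conv_lhs => rw [a.as_sum]
  simp only [map_sum, affine_monomial, finsetSum_coeff, coeff_C_mul, coeff_X_pow, mul_ite,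
    mul_one, mul_zero]
  refine Finset.sum_eq_zero fun m' hm' => ?_
  have := h (MvPolynomial.mem_support_iff.1 hm')
  rw [weight_eq, Prod.ext_iff] at this
  obtain ⟨h1, h2⟩ := this
  simp only at h1 h2
  by_cases e2 : k = m' 2
  · by_cases e1 : j = m' 1
    · subst e1 e2; omega
    · simp [e1, e2]
  · simp [e2]

lemma eq_zero_of_affine_eq_zero {d : ℕ} {a : Cox} {n : ℕ × ℕ} (h : IsHomog d a n)
    (h0 : affine a = 0) : a = 0 := by
  ext m
  by_contra hm
  apply hm
  rw [← coeff_coeff_affine h m (h hm), h0]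
  simp

lemma eq_of_affine_eq {d : ℕ} {a b : Cox} {n : ℕ × ℕ} (ha : IsHomog d a n) (hb : IsHomog d b n)
    (h : affine a = affine b) : a = b :=
  sub_eq_zero.1 (eq_zero_of_affine_eq_zero (ha.sub hb) (by rw [map_sub, h, sub_self]))

lemma eq_of_dehom_eq {d : ℕ} {a b : Cox} {n : ℕ × ℕ} (ha : IsHomog d a n) (hb : IsHomog d b n)
    (h : dehom a = dehom b) : a = b :=
  eq_of_affine_eq ha hb (toFunField_injective (by rwa [dehom_eq, dehom_eq] at h))

lemma dehom_ne_zero {d : ℕ} {a : Cox} {n : ℕ × ℕ} (h : IsHomog d a n) (ha : a ≠ 0) :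
    dehom a ≠ 0 := fun h0 =>
  ha (eq_of_dehom_eq h (MvPolynomial.isWeightedHomogeneous_zero ℂ _ n) (by rw [h0, map_zero]))

/-- Every polynomial in `t` and `u` has a homogenization in each sufficiently large class. -/
lemma exists_homogenization (d : ℕ) (a : ℂ[X][X]) :
    ∃ m n : ℕ, ∀ M N, m ≤ M → n ≤ N → ∃ b : Cox, IsHomog d b (M, N) ∧ affine b = a := by
  induction a using Polynomial.induction_on' with
  | add p q hp hq =>
    obtain ⟨m, n, h⟩ := hp
    obtain ⟨m', n', h'⟩ := hq
    refine ⟨max m m', max n n', fun M N hM hN => ?_⟩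
    obtain ⟨b, hb, hb'⟩ := h M N (le_trans (le_max_left _ _) hM) (le_trans (le_max_left _ _) hN)
    obtain ⟨c, hc, hc'⟩ := h' M N (le_trans (le_max_right _ _) hM) (le_trans (le_max_right _ _) hN)
    exact ⟨b + c, hb.add hc, by rw [map_add, hb', hc']⟩
  | monomial k q =>
    induction q using Polynomial.induction_on' with
    | add p q hp hq =>
      obtain ⟨m, n, h⟩ := hp
      obtain ⟨m', n', h'⟩ := hq
      refine ⟨max m m', max n n', fun M N hM hN => ?_⟩
      obtain ⟨b, hb, hb'⟩ := h M N (le_trans (le_max_left _ _) hM) (le_trans (le_max_left _ _) hN)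
      obtain ⟨c, hc, hc'⟩ :=
        h' M N (le_trans (le_max_right _ _) hM) (le_trans (le_max_right _ _) hN)
      exact ⟨b + c, hb.add hc, by rw [map_add, hb', hc', map_add]⟩
    | monomial j r =>
      refine ⟨j + d * k, k, fun M N hM hN => ?_⟩
      let e : Fin 4 →₀ ℕ := Finsupp.equivFunOnFinite.symm ![M - (j + d * k), j, k, N - k]
      refine ⟨MvPolynomial.monomial e r, MvPolynomial.isWeightedHomogeneous_monomial _ _ _ ?_, ?_⟩
      · rw [weight_eq]
        simp only [e, Finsupp.equivFunOnFinite_symm_apply_apply, Matrix.cons_val]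
        ext <;> simp <;> omega
      · rw [affine_monomial]
        simp [e, C_mul_X_pow_eq_monomial]

lemma exists_homogenization₂ (d : ℕ) (a b : ℂ[X][X]) : ∃ (n : ℕ × ℕ) (A B : Cox),
    IsHomog d A n ∧ IsHomog d B n ∧ affine A = a ∧ affine B = b := by
  obtain ⟨m, n, h⟩ := exists_homogenization d a
  obtain ⟨m', n', h'⟩ := exists_homogenization d b
  obtain ⟨A, hA, hA'⟩ := h (max m m') (max n n') (le_max_left _ _) (le_max_left _ _)
  obtain ⟨B, hB, hB'⟩ := h' (max m m') (max n n') (le_max_right _ _) (le_max_right _ _)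
  exact ⟨_, A, B, hA, hB, hA', hB'⟩

/-- Every rational function is a quotient of two coprime homogeneous elements of the same class. -/
lemma exists_reduced_fraction (d : ℕ) (z : FunField) : ∃ (n : ℕ × ℕ) (A B : Cox),
    IsHomog d A n ∧ IsHomog d B n ∧ B ≠ 0 ∧ IsRelPrime A B ∧ z * dehom B = dehom A := by
  obtain ⟨a, b, hb, hz⟩ := exists_toFunField_div z
  obtain ⟨n, A, B, hA, hB, rfl, rfl⟩ := exists_homogenization₂ d a b
  have hB0 : B ≠ 0 := by rintro rfl; exact hb (map_zero _)
  obtain ⟨B', A', c, hrel, hcB, hcA⟩ := UniqueFactorizationMonoid.exists_reduced_factors B hB0 A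
  subst hcB hcA
  have hc : c ≠ 0 := left_ne_zero_of_mul hB0
  have hB'0 : B' ≠ 0 := right_ne_zero_of_mul hB0
  obtain ⟨k, l, hk, hl, hkl⟩ := hB.of_mul hB0
  refine ⟨l, A', B', ?_, hl, hB'0, hrel.symm, ?_⟩
  · by_cases hA0 : A' = 0
    · rw [hA0]; exact MvPolynomial.isWeightedHomogeneous_zero ℂ _ _
    · obtain ⟨k', l', hk', hl', hkl'⟩ := hA.of_mul (mul_ne_zero hc hA0)
      rw [hk'.inj_right hc hk, ← hkl, add_right_inj] at hkl'
      rwa [← hkl']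
  · have hc' : toFunField (affine c) ≠ 0 := by rw [← dehom_eq]; exact dehom_ne_zero hk hc
    rw [dehom_eq, dehom_eq]
    apply mul_left_cancel₀ hc'
    rw [map_mul, map_mul, map_mul, map_mul] at hz
    linear_combination hz

/-! ### The local rings of the Hirzebruch surface -/

section LocalRing

variable {d : ℕ} {𝔭 : Ideal Cox} [h𝔭 : 𝔭.IsPrime]

omit h𝔭 in
lemma ne_zero_of_notMem {b : Cox} (hb : b ∉ 𝔭) : b ≠ 0 := by
  rintro rfl; exact hb 𝔭.zero_mem

lemma div_mem_localRing {n : ℕ × ℕ} {a b : Cox} (ha : IsHomog d a n) (hb : IsHomog d b n)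
    (hb' : b ∉ 𝔭) : dehom a / dehom b ∈ localRing d 𝔭 :=
  ⟨n, a, b, ha, hb, hb', div_mul_cancel₀ _ (dehom_ne_zero hb (ne_zero_of_notMem hb'))⟩

lemma isUnit_localRing_iff (r : localRing d 𝔭) {n : ℕ × ℕ} {a b : Cox} (ha : IsHomog d a n)
    (hb : IsHomog d b n) (hb' : b ∉ 𝔭) (hr : (r : FunField) * dehom b = dehom a) :
    IsUnit r ↔ a ∉ 𝔭 := by
  constructor
  · rintro hu ha'
    obtain ⟨s, hs⟩ := hu.exists_right_inv
    obtain ⟨m, a₁, b₁, ha₁, hb₁, hb₁', hs₁⟩ := s.2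
    have h1 : (r : FunField) * s = 1 := congrArg Subtype.val hs
    have : a * a₁ = b * b₁ := by
      refine eq_of_dehom_eq (ha.mul ha₁) (hb.mul hb₁) ?_
      rw [map_mul, map_mul, ← hr, ← hs₁]
      linear_combination dehom b * dehom b₁ * h1
    have h2 : b * b₁ ∈ 𝔭 := this ▸ 𝔭.mul_mem_right _ ha'
    exact (h𝔭.mem_or_mem h2).elim hb' hb₁'
  · intro ha'
    have hb0 := dehom_ne_zero hb (ne_zero_of_notMem hb')
    have ha0 := dehom_ne_zero ha (ne_zero_of_notMem ha')
    refine IsUnit.of_mul_eq_one ⟨dehom b / dehom a, div_mem_localRing hb ha ha'⟩ ?_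
    apply Subtype.ext
    change (r : FunField) * (dehom b / dehom a) = 1
    rw [← mul_div_assoc, hr, div_self ha0]

instance localRing_isLocalRing : IsLocalRing (localRing d 𝔭) := by
  refine IsLocalRing.of_isUnit_or_isUnit_one_sub_self fun r => ?_
  obtain ⟨n, a, b, ha, hb, hb', hr⟩ := r.2
  rw [isUnit_localRing_iff r ha hb hb' hr, isUnit_localRing_iff (1 - r) (hb.sub ha) hb hb'
    (by rw [map_sub, ← hr]; push_cast; ring)]
  by_contra! h
  exact hb' (by simpa using 𝔭.add_mem h.2 h.1)

lemma mem_localRing_iff_of_isRelPrime {z : FunField} {n : ℕ × ℕ} {A B : Cox} (hA : IsHomog d A n)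
    (hB : IsHomog d B n) (h : IsRelPrime A B) (hz : z * dehom B = dehom A) :
    z ∈ localRing d 𝔭 ↔ B ∉ 𝔭 := by
  refine ⟨?_, fun hB' => ⟨n, A, B, hA, hB, hB', hz⟩⟩
  rintro ⟨m, a, b, ha, hb, hb', hz'⟩ hB'
  have : A * b = a * B := by
    refine eq_of_dehom_eq (hA.mul hb) (by rw [add_comm]; exact ha.mul hB) ?_
    rw [map_mul, map_mul, ← hz, ← hz']; ring
  exact hb' (𝔭.mem_of_dvd (h.symm.dvd_of_dvd_mul_left (Dvd.intro_left a this.symm)) hB')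

lemma exists_prime_dvd_mem {B : Cox} (hB0 : B ≠ 0) (hB : B ∈ 𝔭) :
    ∃ π : Cox, Prime π ∧ π ∣ B ∧ π ∈ 𝔭 := by
  obtain ⟨f, hf, hf'⟩ := UniqueFactorizationMonoid.exists_prime_factors B hB0
  replace hB := 𝔭.mem_of_dvd hf'.symm.dvd hB
  rw [h𝔭.multiset_prod_mem_iff_exists_mem] at hB
  obtain ⟨π, hπ, hπ'⟩ := hB
  exact ⟨π, hf π hπ, (Multiset.dvd_prod hπ).trans hf'.dvd, hπ'⟩

/-- The valuation ring of a prime divisor. -/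
def divisorValuation (d : ℕ) {π : Cox} (hπ : Prime π) : ValuationSubring FunField :=
  haveI : (Ideal.span {π}).IsPrime := (Ideal.span_singleton_prime hπ.ne_zero).2 hπ
  { (localRing d (Ideal.span {π})).toSubring with
    mem_or_inv_mem' := fun z => by
      obtain ⟨n, A, B, hA, hB, hB0, hrel, hz⟩ := exists_reduced_fraction d z
      by_cases hB' : B ∈ Ideal.span {π}
      · right
        have hA' : A ∉ Ideal.span {π} := fun hA' => hπ.not_isUnit
          (hrel (Ideal.mem_span_singleton.1 hA') (Ideal.mem_span_singleton.1 hB'))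
        have hA0 := dehom_ne_zero hA (ne_zero_of_notMem hA')
        refine ⟨n, B, A, hB, hA, hA', ?_⟩
        have : z ≠ 0 := by rintro rfl; exact hA0 (by rw [← hz, zero_mul])
        rw [← hz, inv_mul_cancel_left₀ this]
      · left
        exact ⟨n, A, B, hA, hB, hB', hz⟩ }

/-- The local rings are integrally closed, because each is the intersection of the valuation rings
of the prime divisors passing through the point. -/
lemma mem_localRing_of_isIntegral {z : FunField} (hz : IsIntegral (localRing d 𝔭) z) :
    z ∈ localRing d 𝔭 := by
  obtain ⟨n, A, B, hA, hB, hB0, hrel, hzAB⟩ := exists_reduced_fraction d z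
  rw [mem_localRing_iff_of_isRelPrime hA hB hrel hzAB]
  intro hB'
  obtain ⟨π, hπ, hπB, hπ𝔭⟩ := exists_prime_dvd_mem hB0 hB'
  have : (Ideal.span {π}).IsPrime := (Ideal.span_singleton_prime hπ.ne_zero).2 hπ
  have hle : (localRing d 𝔭).toSubring ≤ (divisorValuation d hπ).toSubring := by
    rintro w ⟨m, a, b, ha, hb, hb', hw⟩
    refine ⟨m, a, b, ha, hb, fun h => hb' ?_, hw⟩
    exact 𝔭.mem_of_dvd (Ideal.mem_span_singleton.1 h) hπ𝔭
  have hz' : IsIntegral (divisorValuation d hπ) z := by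
    obtain ⟨p, hp, hp0⟩ := hz
    refine ⟨p.map (Subring.inclusion hle), hp.map _, ?_⟩
    rw [eval₂_map]; exact hp0
  obtain ⟨w, hw⟩ := IsIntegrallyClosed.isIntegral_iff.1 hz'
  have : z ∈ localRing d (Ideal.span {π}) := by
    rw [← hw]; exact w.2
  rw [mem_localRing_iff_of_isRelPrime hA hB hrel hzAB] at this
  exact this (Ideal.mem_span_singleton.2 hπB)

/-- If `H` is squarefree, then `h = H f² / e²`, with `e`, `f` invertible at `𝔭`, is squarefree in the
local ring at `𝔭`. -/
lemma mem_localRing_of_sq_mul_mem {H e f : Cox} {n k l : ℕ × ℕ} (hH : IsHomog d H n)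
    (hsq : Squarefree H) (he : IsHomog d e k) (hf : IsHomog d f l) (hkl : k + k = n + (l + l))
    (he' : e ∉ 𝔭) (hf' : f ∉ 𝔭) {z : FunField}
    (hz : z ^ 2 * (dehom H * (dehom f / dehom e) ^ 2) ∈ localRing d 𝔭) : z ∈ localRing d 𝔭 := by
  obtain ⟨m, A, B, hA, hB, hB0, hrel, hzAB⟩ := exists_reduced_fraction d z
  rw [mem_localRing_iff_of_isRelPrime hA hB hrel hzAB]
  intro hB'
  obtain ⟨π, hπ, hπB, hπ𝔭⟩ := exists_prime_dvd_mem hB0 hB'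
  obtain ⟨c, C, E, hC, hE, hE', hCE⟩ := hz
  have he0 := dehom_ne_zero he (ne_zero_of_notMem he')
  have key : (A * A) * H * (f * f) * E = C * (B * B) * (e * e) := by
    refine eq_of_dehom_eq (d := d) (n := m + m + n + (l + l) + c)
      (((hA.mul hA).mul hH).mul (hf.mul hf) |>.mul hE) ?_ ?_
    · have := (hC.mul (hB.mul hB)).mul (he.mul he)
      rw [hkl] at this
      convert this using 1
      abel
    · simp only [map_mul]
      rw [← hCE, ← hzAB]
      field_simp
  have hnd : ∀ x : Cox, x ∉ 𝔭 → ¬ π ∣ x := fun x hx hd => hx (𝔭.mem_of_dvd hd hπ𝔭)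
  have hπA : ¬ π ∣ A := fun h => hπ.not_isUnit (hrel h hπB)
  have h2 : π ^ 2 ∣ (A * A * (f * f) * E) * H := by
    rw [show A * A * (f * f) * E * H = (A * A) * H * (f * f) * E by ring, key, sq]
    exact ((mul_dvd_mul hπB hπB).mul_left C).mul_right _
  have h3 : π ^ 2 ∣ H := by
    refine hπ.pow_dvd_of_dvd_mul_left 2 ?_ h2
    simp only [hπ.dvd_mul, hπA, hnd f hf', hnd E hE', or_self, not_false_iff]
  exact hπ.not_isUnit (hsq π (by rwa [← sq]))

lemma Curve.ideal_eq_maximalIdeal (C : Curve d) :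
    C.ideal C.prime = IsLocalRing.maximalIdeal C.localRing := by
  ext r
  rw [IsLocalRing.mem_maximalIdeal, mem_nonunits_iff]
  constructor
  · rintro ⟨n, a, b, ha, hb, hb', hd, hr⟩
    rw [isUnit_localRing_iff r ha hb hb' hr, not_not]
    exact Ideal.mem_span_singleton.2 hd
  · intro h
    obtain ⟨n, a, b, ha, hb, hb', hr⟩ := r.2
    rw [isUnit_localRing_iff r ha hb hb' hr, not_not] at h
    exact ⟨n, a, b, ha, hb, hb', Ideal.mem_span_singleton.1 h, hr⟩

end LocalRing

/-- The residue field at a point is `ℂ`. -/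
lemma Pt.exists_sub_mem_maximalIdeal {d : ℕ} {p : Pt} (r : p.localRing d) :
    ∃ c : ℂ, r - algebraMap ℂ _ c ∈ IsLocalRing.maximalIdeal (p.localRing d) := by
  obtain ⟨n, a, b, ha, hb, hb', hr⟩ := r.2
  have hb0 : MvPolynomial.eval p.coord b ≠ 0 := hb'
  refine ⟨MvPolynomial.eval p.coord a / MvPolynomial.eval p.coord b, ?_⟩
  set c := MvPolynomial.eval p.coord a / MvPolynomial.eval p.coord b with hc
  rw [IsLocalRing.mem_maximalIdeal, mem_nonunits_iff,
    isUnit_localRing_iff _ (ha.sub (hb.C_mul c)) hb hb', not_not]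
  · change MvPolynomial.eval p.coord _ = 0
    rw [map_sub, map_mul, MvPolynomial.eval_C, hc, div_mul_cancel₀ _ hb0, sub_self]
  · rw [map_sub, map_mul, ← hr, Subalgebra.coe_sub, sub_mul, ← MvPolynomial.algebraMap_eq,
      AlgHom.commutes]
    rfl

/-- Even classes are locally trivial modulo squares of rational functions. -/
lemma Pt.exists_trivialization (d : ℕ) (p : Pt) (n : ℕ × ℕ) : ∃ (k l : ℕ × ℕ) (e f : Cox),
    IsHomog d e k ∧ IsHomog d f l ∧ k = n + l ∧ e ∉ p.prime ∧ f ∉ p.prime := by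
  obtain ⟨i, hi, hi'⟩ : ∃ i, weight d i = (1, 0) ∧ p.coord i ≠ 0 :=
    p.base_ne.elim (fun h => ⟨0, rfl, h⟩) (fun h => ⟨1, rfl, h⟩)
  have hX : ∀ j, p.coord j ≠ 0 → MvPolynomial.X j ∉ p.prime := fun j hj h => by
    have : MvPolynomial.eval p.coord (MvPolynomial.X j) = 0 := h
    rw [MvPolynomial.eval_X] at this
    exact hj this
  have hpow : ∀ (x : Cox) (k : ℕ), x ∉ p.prime → x ^ k ∉ p.prime := fun x k hx h =>
    hx (p.prime_isPrime.mem_of_pow_mem _ h)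
  have hmul : ∀ x y : Cox, x ∉ p.prime → y ∉ p.prime → x * y ∉ p.prime := fun x y hx hy h =>
    (p.prime_isPrime.mem_or_mem h).elim hx hy
  by_cases h3 : p.coord 3 = 0
  · have h2 : p.coord 2 ≠ 0 := p.fibre_ne.resolve_right (not_not.2 h3)
    refine ⟨_, _, MvPolynomial.X i ^ n.1 * MvPolynomial.X 2 ^ n.2,
      MvPolynomial.X i ^ (d * n.2), ((isHomog_X d i).pow _).mul ((isHomog_X d 2).pow _),
      (isHomog_X d i).pow _, ?_, hmul _ _ (hpow _ _ (hX i hi')) (hpow _ _ (hX 2 h2)),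
      hpow _ _ (hX i hi')⟩
    rw [hi]
    ext <;> simp [weight, mul_comm]
  · refine ⟨_, _, MvPolynomial.X i ^ n.1 * MvPolynomial.X 3 ^ n.2,
      1, ((isHomog_X d i).pow _).mul ((isHomog_X d 3).pow _),
      MvPolynomial.isWeightedHomogeneous_one ℂ _, ?_,
      hmul _ _ (hpow _ _ (hX i hi')) (hpow _ _ (hX 3 h3)),
      fun h => p.prime_isPrime.ne_top ((Ideal.eq_top_iff_one _).2 h)⟩
    rw [hi]
    ext <;> simp [weight]

end Hirzebruch

/-! ### Quadratic extensions -/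

namespace QuadraticExtension

section Field

variable {K L L' : Type*} [Field K] [Field L] [Algebra K L] [Field L'] [Algebra K L']

/-- The basis `1, η` of a quadratic extension. -/
def basisOfNotMem (hfin : Module.finrank K L = 2) {η : L} (hη : η ∉ Set.range (algebraMap K L)) :
    Module.Basis (Fin 2) K L :=
  basisOfLinearIndependentOfCardEqFinrank (b := ![1, η]) (by
    rw [LinearIndependent.pair_iff]
    intro s t hst
    have ht : t = 0 := by
      by_contra ht
      apply hη
      refine ⟨-s / t, ?_⟩
      rw [Algebra.smul_def, Algebra.smul_def, mul_one] at hst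
      have ht' : algebraMap K L t ≠ 0 := by simpa using ht
      rw [map_div₀, map_neg, div_eq_iff ht']
      linear_combination -hst
    subst ht
    simpa using hst) (by simp [hfin])

lemma basisOfNotMem_zero (hfin : Module.finrank K L = 2) {η : L}
    (hη : η ∉ Set.range (algebraMap K L)) : basisOfNotMem hfin hη 0 = 1 := by
  simp [basisOfNotMem]

lemma basisOfNotMem_one (hfin : Module.finrank K L = 2) {η : L}
    (hη : η ∉ Set.range (algebraMap K L)) : basisOfNotMem hfin hη 1 = η := by
  simp [basisOfNotMem]

lemma exists_eq_add_mul (hfin : Module.finrank K L = 2) {η : L}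
    (hη : η ∉ Set.range (algebraMap K L)) (x : L) :
    ∃ a b : K, x = algebraMap K L a + algebraMap K L b * η := by
  have := (basisOfNotMem hfin hη).sum_repr x
  rw [Fin.sum_univ_two, basisOfNotMem_zero, basisOfNotMem_one, Algebra.smul_def,
    Algebra.smul_def, mul_one] at this
  exact ⟨_, _, this.symm⟩

/-- Square roots of the same element generate isomorphic quadratic extensions. -/
lemma exists_algEquiv (hfin : Module.finrank K L = 2) (hfin' : Module.finrank K L' = 2) {h : K}
    {η : L} (hη : η ∉ Set.range (algebraMap K L)) (hη2 : η ^ 2 = algebraMap K L h)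
    {η' : L'} (hη' : η' ∉ Set.range (algebraMap K L')) (hη2' : η' ^ 2 = algebraMap K L' h) :
    ∃ φ : L ≃ₐ[K] L', φ η = η' := by
  let e := (basisOfNotMem hfin hη).equiv (basisOfNotMem hfin' hη') (Equiv.refl _)
  have e0 : e 1 = 1 := by
    conv_lhs => rw [← basisOfNotMem_zero hfin hη]
    rw [Module.Basis.equiv_apply, Equiv.refl_apply, basisOfNotMem_zero]
  have e1 : e η = η' := by
    conv_lhs => rw [← basisOfNotMem_one hfin hη]
    rw [Module.Basis.equiv_apply, Equiv.refl_apply, basisOfNotMem_one]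
  have he : ∀ a b : K, e (algebraMap K L a + algebraMap K L b * η) =
      algebraMap K L' a + algebraMap K L' b * η' := by
    intro a b
    rw [← mul_one (algebraMap K L a), ← Algebra.smul_def, ← Algebra.smul_def, map_add, map_smul,
      map_smul, e0, e1, Algebra.smul_def, Algebra.smul_def, mul_one]
  refine ⟨AlgEquiv.ofLinearEquiv e e0 fun x y => ?_, e1⟩
  obtain ⟨a, b, rfl⟩ := exists_eq_add_mul hfin hη x
  obtain ⟨a', b', rfl⟩ := exists_eq_add_mul hfin hη y
  rw [he, he, show (algebraMap K L a + algebraMap K L b * η) *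
      (algebraMap K L a' + algebraMap K L b' * η) =
      algebraMap K L (a * a' + b * b' * h) + algebraMap K L (a * b' + a' * b) * η by
    simp only [map_add, map_mul, ← hη2]; ring, he]
  simp only [map_add, map_mul, ← hη2']; ring

lemma exists_conj [CharZero K] (hfin : Module.finrank K L = 2) {h : K} {η : L}
    (hη : η ∉ Set.range (algebraMap K L)) (hη2 : η ^ 2 = algebraMap K L h) :
    ∃ σ : L ≃ₐ[K] L, σ η = -η ∧ σ ≠ 1 := by
  have hη' : -η ∉ Set.range (algebraMap K L) := by
    rintro ⟨a, ha⟩; exact hη ⟨-a, by rw [map_neg, ha, neg_neg]⟩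
  obtain ⟨σ, hσ⟩ := exists_algEquiv hfin hfin hη hη2 hη' (by rw [neg_sq, hη2])
  refine ⟨σ, hσ, ?_⟩
  rintro rfl
  have : CharZero L := charZero_of_injective_algebraMap (algebraMap K L).injective
  have h0 : η = 0 := by
    rw [AlgEquiv.one_apply] at hσ
    exact self_eq_neg.1 hσ
  exact hη ⟨0, by rw [map_zero, h0]⟩

/-- Completing the square. -/
lemma exists_sqrt_generator [CharZero K] (hfin : Module.finrank K L = 2) :
    ∃ (h : K) (η : L), η ∉ Set.range (algebraMap K L) ∧ η ^ 2 = algebraMap K L h := by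
  obtain ⟨x, hx⟩ : ∃ x : L, x ∉ Set.range (algebraMap K L) := by
    by_contra! hall
    have : Module.finrank K L = 1 := finrank_eq_one 1 one_ne_zero fun w => by
      obtain ⟨a, ha⟩ := hall w
      exact ⟨a, by rw [← ha, Algebra.smul_def, mul_one]⟩
    omega
  obtain ⟨a, b, hab⟩ := exists_eq_add_mul hfin hx (x ^ 2)
  refine ⟨a + b ^ 2 / 4, x - algebraMap K L (b / 2), ?_, ?_⟩
  · rintro ⟨c, hc⟩
    exact hx ⟨c + b / 2, by rw [map_add, hc, sub_add_cancel]⟩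
  · have : CharZero L := charZero_of_injective_algebraMap (algebraMap K L).injective
    simp only [map_add, map_div₀, map_pow, map_ofNat]
    linear_combination hab

lemma adjoin_eq_top (hfin : Module.finrank K L = 2) {η : L}
    (hη : η ∉ Set.range (algebraMap K L)) : IntermediateField.adjoin K {η} = ⊤ := by
  rw [eq_top_iff]
  intro x _
  obtain ⟨a, b, rfl⟩ := exists_eq_add_mul hfin hη x
  exact add_mem (algebraMap_mem _ a) (mul_mem (algebraMap_mem _ b)
    (IntermediateField.mem_adjoin_simple_self K η))

end Field

/-! ### Integral closures in quadratic extensions -/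

section Integral

variable {F K L : Type*} [Field F] [Field K] [Field L] [Algebra F K] [Algebra K L]

/-- `L` is the quadratic extension of `K` generated by a square root `η` of the element `h` of `R`,
and `R` is integrally closed in `K` and `h` squarefree in `R`, so that `R + R η` is the integral
closure of `R` in `L`. -/
structure IsSquarefreeRoot (R : Subalgebra F K) (h : R) (η : L) : Prop where
  finrank_eq : Module.finrank K L = 2
  notMem : η ∉ Set.range (algebraMap K L)
  sq_eq : η ^ 2 = algebraMap K L h
  mem_of_isIntegral : ∀ z : K, IsIntegral R z → z ∈ R
  mem_of_sq_mul_mem : ∀ z : K, z ^ 2 * h ∈ R → z ∈ R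

variable [CharZero K] {R : Subalgebra F K} {h : R} {η : L}

namespace IsSquarefreeRoot

omit [CharZero K] in
lemma isIntegral (H : IsSquarefreeRoot R h η) : IsIntegral R η := by
  refine IsIntegral.of_pow two_pos ?_
  rw [H.sq_eq]
  exact isIntegral_algebraMap (R := R) (A := L) (x := h)

/-- `η` as an element of the integral closure. -/
def root (H : IsSquarefreeRoot R h η) : integralClosure R L := ⟨η, H.isIntegral⟩

omit [CharZero K] in
lemma root_sq (H : IsSquarefreeRoot R h η) :
    H.root ^ 2 = algebraMap R (integralClosure R L) h :=
  Subtype.ext H.sq_eq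

/-- `R + R η` is the integral closure of `R`: the trace of an integral element `a + b η` gives
`a ∈ R`, then `b² h = (b η)²` is in `R`, so that `b ∈ R` because `h` is squarefree. -/
lemma exists_eq (H : IsSquarefreeRoot R h η) (x : integralClosure R L) :
    ∃ a b : R, x = algebraMap R _ a + algebraMap R _ b * H.root := by
  obtain ⟨a, b, hab⟩ := exists_eq_add_mul H.finrank_eq H.notMem (x : L)
  obtain ⟨σ, hσ, -⟩ := exists_conj H.finrank_eq H.notMem H.sq_eq
  have : CharZero L := charZero_of_injective_algebraMap (algebraMap K L).injective
  have hint : IsIntegral R (x : L) := x.2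
  have hσint : IsIntegral R (σ x) := hint.map (σ.restrictScalars R)
  have hσx : σ x = algebraMap K L a - algebraMap K L b * η := by
    rw [hab, map_add, map_mul, σ.commutes, σ.commutes, hσ]; ring
  have h2 : IsIntegral R (algebraMap K L (2⁻¹ : K)) := by
    have := isIntegral_algebraMap (R := R) (A := L) (x := algebraMap F R 2⁻¹)
    convert this using 1
    rw [IsScalarTower.algebraMap_apply R K L]
    congr 1
    change (2⁻¹ : K) = algebraMap F K 2⁻¹
    rw [map_inv₀, map_ofNat]
  have hinj : Function.Injective (algebraMap K L) := (algebraMap K L).injective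
  have ha : IsIntegral R (algebraMap K L a) := by
    have h3 : algebraMap K L a = algebraMap K L 2⁻¹ * (x + σ x) := by
      rw [hσx, hab, map_inv₀, map_ofNat]; field
    rw [h3]; exact h2.mul (hint.add hσint)
  have hb : IsIntegral R (algebraMap K L (b ^ 2 * h)) := by
    have h3 : algebraMap K L (b ^ 2 * h) = (x - algebraMap K L a) ^ 2 := by
      rw [hab, map_mul, map_pow, ← H.sq_eq]; ring
    rw [h3]; exact (hint.sub ha).pow 2
  have ha' := H.mem_of_isIntegral a ((isIntegral_algebraMap_iff hinj).1 ha)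
  have hb' := H.mem_of_sq_mul_mem b
    (H.mem_of_isIntegral _ ((isIntegral_algebraMap_iff hinj).1 hb))
  exact ⟨⟨a, ha'⟩, ⟨b, hb'⟩, Subtype.ext hab⟩

/-- The covering involution, on the field and on the integral closure. -/
lemma exists_conj (H : IsSquarefreeRoot R h η) :
    ∃ (σ : L ≃ₐ[K] L) (τ : integralClosure R L ≃ₐ[R] integralClosure R L),
      σ ≠ 1 ∧ (∀ x, (τ x : L) = σ x) ∧ τ H.root = -H.root := by
  obtain ⟨σ, hσ, hσ1⟩ := QuadraticExtension.exists_conj H.finrank_eq H.notMem H.sq_eq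
  exact ⟨σ, (σ.restrictScalars R).mapIntegralClosure, hσ1, fun x => rfl, Subtype.ext hσ⟩

variable [IsLocalRing R]

/-- The ideal of the integral closure generated by the maximal ideal of `R` and `η - w`. -/
def rootIdeal (H : IsSquarefreeRoot R h η) (w : R) : Ideal (integralClosure R L) :=
  (IsLocalRing.maximalIdeal R).map (algebraMap R _) ⊔ Ideal.span {H.root - algebraMap R _ w}

omit [CharZero K] in
lemma sub_mem_rootIdeal (H : IsSquarefreeRoot R h η) (w : R) :
    H.root - algebraMap R _ w ∈ H.rootIdeal w :=
  Ideal.mem_sup_right (Ideal.mem_span_singleton_self _)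

omit [CharZero K] in
lemma map_le_rootIdeal (H : IsSquarefreeRoot R h η) (w : R) :
    (IsLocalRing.maximalIdeal R).map (algebraMap R _) ≤ H.rootIdeal w := le_sup_left

omit [CharZero K] in
lemma rootIdeal_le_iff (H : IsSquarefreeRoot R h η) (w : R) (I : Ideal (integralClosure R L)) :
    H.rootIdeal w ≤ I ↔ (IsLocalRing.maximalIdeal R).map (algebraMap R _) ≤ I ∧
      H.root - algebraMap R _ w ∈ I := by
  rw [rootIdeal, sup_le_iff, Ideal.span_singleton_le_iff_mem]

/-- Modulo `rootIdeal w` every element is congruent to one of `R`, so that the quotient is a quotient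
of the residue field. -/
lemma isMaximal_rootIdeal_of_ne_top (H : IsSquarefreeRoot R h η) (w : R)
    (hw : H.rootIdeal w ≠ ⊤) : (H.rootIdeal w).IsMaximal := by
  refine Ideal.isMaximal_iff.2 ⟨fun h1 => hw ((Ideal.eq_top_iff_one _).2 h1), ?_⟩
  intro J x hJ hx hxJ
  obtain ⟨a, b, rfl⟩ := H.exists_eq x
  have h1 : algebraMap R _ a + algebraMap R _ b * H.root - algebraMap R _ (a + b * w) ∈
      H.rootIdeal w := by
    have := (H.rootIdeal w).mul_mem_left (algebraMap R _ b) (H.sub_mem_rootIdeal w)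
    convert this using 1
    rw [map_add, map_mul]; ring
  have h2 : IsUnit (a + b * w) := by
    by_contra h2
    apply hx
    have h3 := H.map_le_rootIdeal w (Ideal.mem_map_of_mem (algebraMap R _)
      ((IsLocalRing.mem_maximalIdeal _).2 h2))
    have := add_mem h1 h3
    rwa [sub_add_cancel] at this
  have h3 : algebraMap R (integralClosure R L) (a + b * w) ∈ J := by
    have := sub_mem hxJ (hJ h1)
    rwa [sub_sub_cancel] at this
  have := J.eq_top_of_isUnit_mem h3 (h2.map _)
  rw [this]; trivial

omit [CharZero K] in
lemma map_maximalIdeal_le (M : Ideal (integralClosure R L)) [hM : M.IsMaximal] :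
    (IsLocalRing.maximalIdeal R).map (algebraMap R _) ≤ M := by
  rw [Ideal.map_le_iff_le_comap]
  have : (M.comap (algebraMap R _)).IsMaximal :=
    Ideal.isMaximal_comap_of_isIntegral_of_isMaximal (R := R) M
  exact (IsLocalRing.eq_maximalIdeal this).ge

omit [CharZero K] in
lemma sub_mul_add_mem (H : IsSquarefreeRoot R h η) {w : R}
    (hw : h - w ^ 2 ∈ IsLocalRing.maximalIdeal R) :
    (H.root - algebraMap R _ w) * (H.root - algebraMap R _ (-w)) ∈
      (IsLocalRing.maximalIdeal R).map (algebraMap R (integralClosure R L)) := by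
  convert Ideal.mem_map_of_mem (algebraMap R (integralClosure R L)) hw using 1
  rw [map_sub, map_pow, ← H.root_sq, map_neg]; ring

omit [CharZero K] in
lemma le_of_isMaximal (H : IsSquarefreeRoot R h η) {w : R}
    (hw : h - w ^ 2 ∈ IsLocalRing.maximalIdeal R) (M : Ideal (integralClosure R L))
    [hM : M.IsMaximal] : H.rootIdeal w ≤ M ∨ H.rootIdeal (-w) ≤ M := by
  have h1 := map_maximalIdeal_le M
  simp only [rootIdeal_le_iff, h1, true_and]
  exact hM.isPrime.mem_or_mem (h1 (H.sub_mul_add_mem hw))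

omit [CharZero K] in
lemma map_rootIdeal (H : IsSquarefreeRoot R h η)
    (τ : integralClosure R L ≃ₐ[R] integralClosure R L) (hτ : τ H.root = -H.root) (w : R)
    {x : integralClosure R L} (hx : x ∈ H.rootIdeal w) : τ x ∈ H.rootIdeal (-w) := by
  have : H.rootIdeal w ≤ (H.rootIdeal (-w)).comap τ := by
    rw [rootIdeal_le_iff]
    constructor
    · rw [Ideal.map_le_iff_le_comap]
      intro r hr
      rw [Ideal.mem_comap, Ideal.mem_comap, τ.commutes]
      exact H.map_le_rootIdeal _ (Ideal.mem_map_of_mem _ hr)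
    · rw [Ideal.mem_comap, map_sub, τ.commutes, hτ]
      convert neg_mem (H.sub_mem_rootIdeal (-w)) using 1
      rw [map_neg]; ring
  exact this hx

omit [CharZero K] in
lemma map_rootIdeal_iff (H : IsSquarefreeRoot R h η)
    (τ : integralClosure R L ≃ₐ[R] integralClosure R L) (hτ : τ H.root = -H.root) (w : R)
    (x : integralClosure R L) : x ∈ H.rootIdeal w ↔ τ x ∈ H.rootIdeal (-w) := by
  refine ⟨H.map_rootIdeal τ hτ w, fun hx => ?_⟩
  have hτ' : τ.symm H.root = -H.root := by
    rw [AlgEquiv.symm_apply_eq, map_neg, hτ, neg_neg]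
  have := H.map_rootIdeal τ.symm hτ' (-w) hx
  rwa [AlgEquiv.symm_apply_apply, neg_neg] at this

lemma rootIdeal_neg_ne_top (H : IsSquarefreeRoot R h η) {w : R}
    (hw : H.rootIdeal w ≠ ⊤) : H.rootIdeal (-w) ≠ ⊤ := by
  obtain ⟨σ, τ, -, -, hτ⟩ := H.exists_conj
  rw [Ne, Ideal.eq_top_iff_one] at hw ⊢
  rwa [H.map_rootIdeal_iff τ hτ, map_one] at hw

lemma isMaximal_rootIdeal (H : IsSquarefreeRoot R h η) {w : R}
    (hw : h - w ^ 2 ∈ IsLocalRing.maximalIdeal R) : (H.rootIdeal w).IsMaximal := by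
  apply H.isMaximal_rootIdeal_of_ne_top
  obtain ⟨M, hM⟩ := Ideal.exists_maximal (integralClosure R L)
  rcases H.le_of_isMaximal hw M with h1 | h1
  · exact fun h2 => hM.ne_top (top_le_iff.1 (h2 ▸ h1))
  · have := H.rootIdeal_neg_ne_top (w := -w) fun h2 => hM.ne_top (top_le_iff.1 (h2 ▸ h1))
    rwa [neg_neg] at this

lemma isMaximal_rootIdeal_neg (H : IsSquarefreeRoot R h η) {w : R}
    (hw : h - w ^ 2 ∈ IsLocalRing.maximalIdeal R) : (H.rootIdeal (-w)).IsMaximal :=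
  H.isMaximal_rootIdeal (by rwa [neg_sq])

lemma eq_rootIdeal (H : IsSquarefreeRoot R h η) {w : R}
    (hw : h - w ^ 2 ∈ IsLocalRing.maximalIdeal R) (M : Ideal (integralClosure R L))
    [hM : M.IsMaximal] : M = H.rootIdeal w ∨ M = H.rootIdeal (-w) := by
  rcases H.le_of_isMaximal hw M with h1 | h1
  · exact Or.inl ((H.isMaximal_rootIdeal hw).eq_of_le hM.ne_top h1).symm
  · exact Or.inr ((H.isMaximal_rootIdeal_neg hw).eq_of_le hM.ne_top h1).symm

omit [IsLocalRing R] [CharZero K] in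
lemma isUnit_two [CharZero F] : IsUnit (2 : R) := by
  have : IsUnit (algebraMap F R 2) := (IsUnit.mk0 (2 : F) two_ne_zero).map _
  rwa [map_ofNat] at this

lemma rootIdeal_ne [CharZero F] (H : IsSquarefreeRoot R h η) {w : R}
    (hw : h - w ^ 2 ∈ IsLocalRing.maximalIdeal R) (hwu : IsUnit w) :
    H.rootIdeal w ≠ H.rootIdeal (-w) := by
  intro heq
  have h1 := H.sub_mem_rootIdeal (-w)
  rw [← heq] at h1
  have h2 := sub_mem h1 (H.sub_mem_rootIdeal w)
  refine (H.isMaximal_rootIdeal hw).ne_top (Ideal.eq_top_of_isUnit_mem _ h2 ?_)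
  convert (isUnit_two.mul hwu).map (algebraMap R (integralClosure R L)) using 1
  rw [map_mul, map_neg, map_ofNat]; ring

omit [CharZero K] in
/-- The ideal generated by the maximal ideal of `R` splits if `h` is the square of a unit modulo it. -/
lemma rootIdeal_mul [CharZero F] (H : IsSquarefreeRoot R h η) {w : R}
    (hw : h - w ^ 2 ∈ IsLocalRing.maximalIdeal R) (hwu : IsUnit w) :
    (IsLocalRing.maximalIdeal R).map (algebraMap R _) = H.rootIdeal w * H.rootIdeal (-w) := by
  apply le_antisymm
  · rw [Ideal.map_le_iff_le_comap]
    intro r hr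
    rw [Ideal.mem_comap]
    obtain ⟨v, hv⟩ := (isUnit_two.mul hwu).exists_right_inv
    have hr' := Ideal.mem_map_of_mem (algebraMap R (integralClosure R L)) hr
    have h1 := Ideal.mul_mem_mul (H.map_le_rootIdeal w hr') (H.sub_mem_rootIdeal (-w))
    have h2 := Ideal.mul_mem_mul (H.sub_mem_rootIdeal w) (H.map_le_rootIdeal (-w) hr')
    have h3 := Ideal.mul_mem_left _ (algebraMap R _ v) (sub_mem h1 h2)
    convert h3 using 1
    have hv' := congrArg (algebraMap R (integralClosure R L)) hv
    rw [map_one, map_mul, map_mul, map_ofNat] at hv'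
    rw [map_neg]
    linear_combination -(algebraMap R (integralClosure R L) r) * hv'
  · rw [rootIdeal, rootIdeal, Ideal.sup_mul, sup_le_iff]
    refine ⟨Ideal.mul_le_left, ?_⟩
    rw [Ideal.mul_sup, sup_le_iff]
    refine ⟨Ideal.mul_le_right, ?_⟩
    rw [Ideal.span_singleton_mul_span_singleton, Ideal.span_singleton_le_iff_mem]
    exact H.sub_mul_add_mem hw

/-- If `h` is the square of a unit modulo the maximal ideal, there are two points above. -/
lemma card_maximalSpectrum_eq_two [CharZero F] (H : IsSquarefreeRoot R h η) {w : R}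
    (hw : h - w ^ 2 ∈ IsLocalRing.maximalIdeal R) (hwu : IsUnit w) :
    Nat.card (MaximalSpectrum (integralClosure R L)) = 2 := by
  rw [Nat.card_eq_two_iff]
  refine ⟨⟨_, H.isMaximal_rootIdeal hw⟩, ⟨_, H.isMaximal_rootIdeal_neg hw⟩, fun heq =>
    H.rootIdeal_ne hw hwu (congrArg MaximalSpectrum.asIdeal heq), ?_⟩
  rw [Set.eq_univ_iff_forall]
  rintro ⟨M, hM⟩
  exact (H.eq_rootIdeal hw M).imp (fun h => MaximalSpectrum.ext h) fun h => MaximalSpectrum.ext h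

/-- If `h` is in the maximal ideal, there is one point above. -/
lemma card_maximalSpectrum_eq_one (H : IsSquarefreeRoot R h η)
    (hh : h ∈ IsLocalRing.maximalIdeal R) :
    Nat.card (MaximalSpectrum (integralClosure R L)) = 1 := by
  have hw : h - (0 : R) ^ 2 ∈ IsLocalRing.maximalIdeal R := by simpa using hh
  rw [Nat.card_eq_one_iff_exists]
  refine ⟨⟨_, H.isMaximal_rootIdeal hw⟩, ?_⟩
  rintro ⟨M, hM⟩
  rcases H.eq_rootIdeal hw M with h1 | h1
  · exact MaximalSpectrum.ext h1
  · rw [neg_zero] at h1; exact MaximalSpectrum.ext h1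

/-- If `h` is not a square modulo the maximal ideal, this ideal is inert. -/
lemma eq_map_of_isPrime (H : IsSquarefreeRoot R h η)
    (hns : ∀ w : R, h - w ^ 2 ∉ IsLocalRing.maximalIdeal R) (Q : Ideal (integralClosure R L))
    [hQ : Q.IsPrime] (hle : (IsLocalRing.maximalIdeal R).map (algebraMap R _) ≤ Q) :
    Q = (IsLocalRing.maximalIdeal R).map (algebraMap R _) := by
  refine le_antisymm (fun x hx => ?_) hle
  obtain ⟨a, b, rfl⟩ := H.exists_eq x
  have hcomap : Q.comap (algebraMap R _) = IsLocalRing.maximalIdeal R :=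
    ((IsLocalRing.maximalIdeal.isMaximal R).eq_of_le (Ideal.IsPrime.comap _).ne_top
      (Ideal.map_le_iff_le_comap.1 hle)).symm
  have h1 : a ^ 2 - b ^ 2 * h ∈ IsLocalRing.maximalIdeal R := by
    rw [← hcomap, Ideal.mem_comap]
    convert Q.mul_mem_left (algebraMap R _ a - algebraMap R _ b * H.root) hx using 1
    rw [map_sub, map_mul, map_pow, map_pow, ← H.root_sq]; ring
  have hb : b ∈ IsLocalRing.maximalIdeal R := by
    by_contra hb
    rw [IsLocalRing.mem_maximalIdeal, mem_nonunits_iff, not_not] at hb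
    obtain ⟨c, hc⟩ := hb.exists_right_inv
    apply hns (a * c)
    convert Ideal.mul_mem_left _ (-c ^ 2) h1 using 1
    linear_combination (-h * (1 + b * c)) * hc
  have ha : a ∈ IsLocalRing.maximalIdeal R := by
    have h2 := add_mem h1 (Ideal.mul_mem_left _ (b * h) hb)
    refine (IsLocalRing.maximalIdeal.isMaximal R).isPrime.mem_of_pow_mem 2 ?_
    convert h2 using 1
    ring
  exact add_mem (Ideal.mem_map_of_mem _ ha) (Ideal.mul_mem_right _ _ (Ideal.mem_map_of_mem _ hb))

end IsSquarefreeRoot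

end Integral

end QuadraticExtension

namespace Hirzebruch

/-! ### Double covers and their branch loci -/

instance : CharZero FunField :=
  charZero_of_injective_algebraMap (algebraMap ℂ FunField).injective

/-- The double cover is given by a square root of the function `dehom H`. -/
def DoubleCover.IsSqrtOf (Z : DoubleCover) (H : Cox) : Prop :=
  ∃ η : Z.field, η ∉ Set.range (algebraMap FunField Z.field) ∧
    η ^ 2 = algebraMap FunField Z.field (dehom H)

lemma mul_algebraMap_notMem {K L : Type*} [Field K] [Field L] [Algebra K L] {η : L}
    (hη : η ∉ Set.range (algebraMap K L)) {c : K} (hc : c ≠ 0) :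
    η * algebraMap K L c ∉ Set.range (algebraMap K L) := by
  rintro ⟨a, ha⟩
  refine hη ⟨a / c, ?_⟩
  have hc' : algebraMap K L c ≠ 0 := by simpa using hc
  rw [map_div₀, ha, mul_div_cancel_right₀ _ hc']

/-- The square of a rational function may be removed from the radicand. -/
lemma DoubleCover.IsSqrtOf.of_mul_sq {d : ℕ} {Z : DoubleCover} {x y : Cox} {k : ℕ × ℕ}
    (hx : IsHomog d x k) (hx0 : x ≠ 0) (h : Z.IsSqrtOf (x * x * y)) : Z.IsSqrtOf y := by
  obtain ⟨η, hη, hη2⟩ := h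
  have hx' := dehom_ne_zero hx hx0
  refine ⟨η * algebraMap _ _ (dehom x)⁻¹, mul_algebraMap_notMem hη (inv_ne_zero hx'), ?_⟩
  rw [mul_pow, hη2, ← map_pow, ← map_mul]
  congr 1
  simp only [map_mul]
  field_simp

lemma DoubleCover.IsSqrtOf.of_associated {Z : DoubleCover} {x y : Cox} (hxy : Associated x y)
    (h : Z.IsSqrtOf x) : Z.IsSqrtOf y := by
  obtain ⟨u, rfl⟩ := hxy
  obtain ⟨c, hc, hcu⟩ := MvPolynomial.isUnit_iff_eq_C_of_isReduced.1 u.isUnit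
  obtain ⟨b, hb⟩ := IsSquare.exists_sq c (IsAlgClosed.exists_pow_nat_eq c two_pos |>.imp
    fun z hz => by rw [← hz, sq])
  obtain ⟨η, hη, hη2⟩ := h
  have hb0 : b ≠ 0 := by rintro rfl; simp [hb] at hc
  refine ⟨η * algebraMap _ _ (algebraMap ℂ FunField b),
    mul_algebraMap_notMem hη (by simpa using hb0), ?_⟩
  rw [mul_pow, hη2, ← map_pow, ← map_mul, ← map_pow, ← hb, hcu,
    ← MvPolynomial.algebraMap_eq, map_mul dehom, AlgHom.commutes]

/-- Dividing the radicand by squares lowers its total degree, until it is squarefree; its class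
remains even. -/
lemma exists_squarefree_of_isSqrtOf {d : ℕ} {Z : DoubleCover} :
    ∀ (N : ℕ) (n : ℕ × ℕ) (H : Cox), H.totalDegree < N → IsHomog d H (n + n) → H ≠ 0 →
      Z.IsSqrtOf H → ∃ (m : ℕ × ℕ) (H' : Cox), IsHomog d H' (m + m) ∧ Squarefree H' ∧
        Z.IsSqrtOf H' := by
  intro N
  induction N with
  | zero => intro n H h; omega
  | succ N ih =>
    intro n H hN hH hH0 hZ
    by_cases hsq : Squarefree H
    · exact ⟨n, H, hH, hsq, hZ⟩
    · simp only [Squarefree, not_forall] at hsq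
      obtain ⟨x, ⟨y, rfl⟩, hx⟩ := hsq
      have hxx0 := left_ne_zero_of_mul hH0
      have hy0 := right_ne_zero_of_mul hH0
      have hx0 := left_ne_zero_of_mul hxx0
      obtain ⟨k, l, hk, hl, hkl⟩ := hH.of_mul hH0
      obtain ⟨k', l', hk', hl', hkl'⟩ := hk.of_mul hxx0
      obtain rfl := hk'.inj_right hx0 hl'
      have hdeg : x.totalDegree ≠ 0 := by
        intro h0
        rw [MvPolynomial.totalDegree_eq_zero_iff_eq_C] at h0
        apply hx
        rw [h0]
        refine (IsUnit.mk0 _ fun hc => hx0 ?_).map MvPolynomial.C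
        rw [h0, hc, map_zero]
      rw [MvPolynomial.totalDegree_mul_of_isDomain hxx0 hy0,
        MvPolynomial.totalDegree_mul_of_isDomain hx0 hx0] at hN
      refine ih (l.1 / 2, l.2 / 2) y (by omega) ?_ hy0 (hZ.of_mul_sq hk' hx0)
      convert hl using 1
      rw [← hkl', Prod.ext_iff] at hkl
      simp only [Prod.fst_add, Prod.snd_add] at hkl
      ext <;> simp <;> omega

/-- Every double cover is given by the square root of a squarefree homogeneous equation. -/
lemma DoubleCover.exists_isSqrtOf (d : ℕ) (Z : DoubleCover) : ∃ (n : ℕ × ℕ) (H : Cox),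
    IsHomog d H (n + n) ∧ Squarefree H ∧ Z.IsSqrtOf H := by
  obtain ⟨h, η, hη, hη2⟩ := QuadraticExtension.exists_sqrt_generator Z.finrank_eq
  obtain ⟨n, A, B, hA, hB, hB0, -, hAB⟩ := exists_reduced_fraction d h
  have hB' := dehom_ne_zero hB hB0
  have hZ : Z.IsSqrtOf (A * B) := by
    refine ⟨η * algebraMap _ _ (dehom B), mul_algebraMap_notMem hη hB', ?_⟩
    rw [mul_pow, hη2, ← map_pow, ← map_mul, map_mul dehom, ← hAB]
    congr 1; ring
  refine exists_squarefree_of_isSqrtOf _ n (A * B) (Nat.lt_succ_self _) (hA.mul hB) ?_ hZ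
  intro h0
  obtain ⟨ξ, hξ, hξ2⟩ := hZ
  rw [h0, map_zero, map_zero] at hξ2
  exact hξ ⟨0, by rw [map_zero, pow_eq_zero_iff two_ne_zero |>.1 hξ2]⟩

/-- A double cover given by the square root of a squarefree `H` of even class is, over the local ring
at `𝔭`, given by the square root of the squarefree element `h = H f² / e²`, which is a local equation
of `H`. -/
lemma isSquarefreeRoot {d : ℕ} {𝔭 : Ideal Cox} [h𝔭 : 𝔭.IsPrime] {Z : DoubleCover} {H e f : Cox}
    {η : Z.field} (hη : η ∉ Set.range (algebraMap FunField Z.field))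
    (hη2 : η ^ 2 = algebraMap FunField Z.field (dehom H)) {n k l : ℕ × ℕ}
    (hH : IsHomog d H (n + n)) (hsq : Squarefree H) (he : IsHomog d e k) (hf : IsHomog d f l)
    (hkl : k = n + l) (he' : e ∉ 𝔭) (hf' : f ∉ 𝔭) :
    ∃ h : localRing d 𝔭, (h : FunField) = dehom H * (dehom f / dehom e) ^ 2 ∧
      (h ∈ IsLocalRing.maximalIdeal (localRing d 𝔭) ↔ H ∈ 𝔭) ∧
      QuadraticExtension.IsSquarefreeRoot (localRing d 𝔭) h
        (η * algebraMap FunField Z.field (dehom f / dehom e)) := by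
  have he0 := dehom_ne_zero he (ne_zero_of_notMem he')
  have hf0 := dehom_ne_zero hf (ne_zero_of_notMem hf')
  have hee : e * e ∉ 𝔭 := fun h => (h𝔭.mem_or_mem h).elim he' he'
  have hcls : k + k = n + n + (l + l) := by rw [hkl]; abel
  have hnum : IsHomog d (H * (f * f)) (k + k) := by rw [hcls]; exact hH.mul (hf.mul hf)
  have hval : dehom H * (dehom f / dehom e) ^ 2 = dehom (H * (f * f)) / dehom (e * e) := by
    simp only [map_mul]; field_simp
  refine ⟨⟨dehom H * (dehom f / dehom e) ^ 2, ?_⟩, rfl, ?_, ?_⟩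
  · rw [hval]; exact div_mem_localRing hnum (he.mul he) hee
  · rw [IsLocalRing.mem_maximalIdeal, mem_nonunits_iff,
      isUnit_localRing_iff _ hnum (he.mul he) hee, not_not]
    · refine ⟨fun h => ?_, fun h => 𝔭.mul_mem_right _ h⟩
      exact (h𝔭.mem_or_mem h).resolve_right fun h => (h𝔭.mem_or_mem h).elim hf' hf'
    · simp only [map_mul]; field_simp
  · refine ⟨Z.finrank_eq, mul_algebraMap_notMem hη (div_ne_zero hf0 he0), ?_,
      fun z hz => mem_localRing_of_isIntegral hz,
      fun z hz => mem_localRing_of_sq_mul_mem hH hsq he hf hcls he' hf' hz⟩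
    rw [mul_pow, hη2, ← map_pow, ← map_mul]

/-- The branch locus of the double cover given by the square root of a squarefree equation of even
class is the zero set of the equation. -/
lemma DoubleCover.IsSqrtOf.branchLocus_eq {d : ℕ} {Z : DoubleCover} {H : Cox} {n : ℕ × ℕ}
    (hZ : Z.IsSqrtOf H) (hH : IsHomog d H (n + n)) (hsq : Squarefree H) :
    Z.branchLocus d = {p | MvPolynomial.eval p.coord H = 0} := by
  ext p
  obtain ⟨η, hη, hη2⟩ := hZ
  obtain ⟨k, l, e, f, he, hf, hkl, he', hf'⟩ := p.exists_trivialization d n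
  obtain ⟨h, -, hmem, hroot⟩ := isSquarefreeRoot hη hη2 hH hsq he hf hkl he' hf'
  change Nat.card (MaximalSpectrum (integralClosure (p.localRing d) Z.field)) ≠ 2 ↔ H ∈ p.prime
  rw [← hmem]
  constructor
  -- off the zero set of `H`, the square of a constant is congruent to `h`
  · contrapose!
    intro hh
    obtain ⟨c, hc⟩ := Pt.exists_sub_mem_maximalIdeal h
    obtain ⟨b, hb⟩ := IsAlgClosed.exists_pow_nat_eq c two_pos
    have hw : h - (algebraMap ℂ (p.localRing d) b) ^ 2 ∈
        IsLocalRing.maximalIdeal (p.localRing d) := by rwa [← map_pow, hb]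
    refine hroot.card_maximalSpectrum_eq_two hw ?_
    by_contra hwu
    apply hh
    have := add_mem hw (Ideal.pow_mem_of_mem _ ((IsLocalRing.mem_maximalIdeal _).2 hwu) 2 two_pos)
    rwa [sub_add_cancel] at this
  · intro hh
    rw [hroot.card_maximalSpectrum_eq_one hh]
    norm_num

/-- A squarefree equation divides every polynomial vanishing on the curve that it defines in `Σ_d`.
This is the Nullstellensatz in `ℂ⁴`, where the irrelevant locus has codimension two. -/
lemma dvd_of_zeros_subset {H G : Cox} (hsq : Squarefree H)
    (hHG : ∀ p : Pt, MvPolynomial.eval p.coord H = 0 → MvPolynomial.eval p.coord G = 0) :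
    H ∣ G := by
  have key : ∀ i j : Fin 4, (i = 0 ∨ i = 1) → (j = 2 ∨ j = 3) →
      H ∣ MvPolynomial.X i * MvPolynomial.X j * G := by
    intro i j hi hj
    have hmem : MvPolynomial.X i * MvPolynomial.X j * G ∈
        MvPolynomial.vanishingIdeal ℂ (MvPolynomial.zeroLocus ℂ (Ideal.span {H})) := by
      rw [MvPolynomial.mem_vanishingIdeal_iff]
      intro x hx
      have hxH : MvPolynomial.eval x H = 0 := hx H (Ideal.mem_span_singleton_self H)
      change MvPolynomial.eval x _ = 0
      by_cases hxi : x i = 0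
      · simp [hxi]
      by_cases hxj : x j = 0
      · simp [hxj]
      have hb : x 0 ≠ 0 ∨ x 1 ≠ 0 := by
        rcases hi with rfl | rfl <;> simp [hxi]
      have hf : x 2 ≠ 0 ∨ x 3 ≠ 0 := by
        rcases hj with rfl | rfl <;> simp [hxj]
      rw [map_mul, hHG ⟨x, hb, hf⟩ hxH, mul_zero]
    rw [MvPolynomial.vanishingIdeal_zeroLocus_eq_radical] at hmem
    obtain ⟨N, hN⟩ := hmem
    exact hsq.isRadical N _ (Ideal.mem_span_singleton.1 hN)
  have hrel : ∀ i j : Fin 4, i ≠ j →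
      IsRelPrime (MvPolynomial.X i : Cox) (MvPolynomial.X j) := fun i j hij =>
    (MvPolynomial.X_prime.irreducible.isRelPrime_iff_not_dvd).2 fun h =>
      hij (MvPolynomial.X_dvd_X.1 h)
  -- a factor of `H` dividing `X i` is coprime to `X j`
  have aux : ∀ i j : Fin 4, i ≠ j → ∀ c : Cox, H ∣ MvPolynomial.X i * c →
      H ∣ MvPolynomial.X j * c → H ∣ c := by
    intro i j hij c h1 h2
    obtain ⟨a, b, ha, ⟨c', rfl⟩, rfl⟩ := exists_dvd_and_dvd_of_dvd_mul h1
    have hb0 : b ≠ 0 := right_ne_zero_of_mul hsq.ne_zero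
    rw [mul_comm b, ← mul_assoc] at h2
    rw [mul_comm b]
    exact mul_dvd_mul_right (((hrel i j hij).of_dvd_left ha).dvd_of_dvd_mul_left
      ((mul_dvd_mul_iff_right hb0).1 h2)) b
  refine aux 2 3 (by decide) G ?_ ?_
  · exact aux 0 1 (by decide) _ (by rw [← mul_assoc]; exact key 0 2 (by simp) (by simp))
      (by rw [← mul_assoc]; exact key 1 2 (by simp) (by simp))
  · exact aux 0 1 (by decide) _ (by rw [← mul_assoc]; exact key 0 3 (by simp) (by simp))
      (by rw [← mul_assoc]; exact key 1 3 (by simp) (by simp))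

/-- The square root of a squarefree non-constant equation of even class is not a rational function, so
that it defines a double cover. -/
lemma exists_doubleCover_isSqrtOf {d : ℕ} {H : Cox} {n : ℕ × ℕ} (hH : IsHomog d H (n + n))
    (hsq : Squarefree H) (hu : ¬ IsUnit H) : ∃ Z : DoubleCover, Z.IsSqrtOf H := by
  have hns : ∀ z : FunField, z ^ 2 ≠ dehom H := by
    intro z hz
    obtain ⟨k, A, B, hA, hB, hB0, -, hAB⟩ := exists_reduced_fraction d z
    -- the monomial `s ^ n.1 v ^ n.2` has class `n` and is `1` on the affine chart
    have hAH : A * A * (MvPolynomial.X 0 ^ n.1 * MvPolynomial.X 3 ^ n.2) ^ 2 = H * (B * B) := by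
      have hX : IsHomog d (MvPolynomial.X 0 ^ n.1 * MvPolynomial.X 3 ^ n.2) n := by
        convert ((isHomog_X d 0).pow n.1).mul ((isHomog_X d 3).pow n.2) using 1
        ext <;> simp [weight]
      refine eq_of_dehom_eq (d := d) (n := k + k + (n + n)) ?_ ?_ ?_
      · rw [sq]; exact (hA.mul hA).mul (hX.mul hX)
      · rw [add_comm]; exact hH.mul (hB.mul hB)
      · have h0 : dehom (MvPolynomial.X 0) = 1 := by simp [dehom_eq]
        have h3 : dehom (MvPolynomial.X 3) = 1 := by simp [dehom_eq]
        simp only [map_mul, map_pow, h0, h3, ← hz, ← hAB]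
        ring
    obtain ⟨b, a, c, hrel, hcb, hca⟩ := UniqueFactorizationMonoid.exists_reduced_factors B hB0
      (A * (MvPolynomial.X 0 ^ n.1 * MvPolynomial.X 3 ^ n.2))
    have hc0 : c ≠ 0 := by rintro rfl; exact hB0 (by rw [← hcb, zero_mul])
    have hab : a ^ 2 = H * b ^ 2 := by
      apply mul_left_cancel₀ (pow_ne_zero 2 hc0)
      rw [← mul_pow, hca, mul_pow, sq A, hAH, ← hcb]; ring
    have hbu : IsUnit (b ^ 2) := hrel.pow (m := 2) (n := 2) dvd_rfl (Dvd.intro_left H hab.symm)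
    obtain ⟨v, hv⟩ := hbu
    have h1 : H ∣ a ^ 2 := Dvd.intro _ hab.symm
    have h2 : a ^ 2 ∣ H := by
      rw [hab, ← hv]; exact (Units.mul_right_dvd).2 dvd_rfl
    have hau : IsUnit a := hsq a (by rwa [← sq])
    exact hu (isUnit_of_dvd_unit h1 (hau.pow 2))
  have hirr : Irreducible (X ^ 2 - C (dehom H) : FunField[X]) :=
    X_pow_sub_C_irreducible_of_prime Nat.prime_two hns
  have := Fact.mk hirr
  have hmonic : (X ^ 2 - C (dehom H) : FunField[X]).Monic := monic_X_pow_sub_C _ two_ne_zero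
  have hfin : Module.finrank FunField (AdjoinRoot (X ^ 2 - C (dehom H) : FunField[X])) = 2 := by
    rw [(AdjoinRoot.powerBasis hmonic.ne_zero).finrank, AdjoinRoot.powerBasis_dim,
      natDegree_X_pow_sub_C]
  have hroot : (AdjoinRoot.root (X ^ 2 - C (dehom H) : FunField[X])) ^ 2 =
      algebraMap FunField _ (dehom H) := by
    have := AdjoinRoot.eval₂_root (X ^ 2 - C (dehom H) : FunField[X])
    simpa [sub_eq_zero] using this
  refine ⟨{ field := AdjoinRoot (X ^ 2 - C (dehom H) : FunField[X]), finrank_eq := hfin },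
    AdjoinRoot.root _, ?_, hroot⟩
  rintro ⟨z, hz⟩
  apply hns z
  apply (algebraMap FunField (AdjoinRoot (X ^ 2 - C (dehom H) : FunField[X]))).injective
  rw [map_pow, ← hroot]
  exact congrArg (· ^ 2) hz

lemma DoubleCover.IsSqrtOf.iso {Z Z' : DoubleCover} {H : Cox} (h : Z.IsSqrtOf H)
    (h' : Z'.IsSqrtOf H) : Z.Iso Z' := by
  obtain ⟨η, hη, hη2⟩ := h
  obtain ⟨η', hη', hη2'⟩ := h'
  exact ⟨(QuadraticExtension.exists_algEquiv Z.finrank_eq Z'.finrank_eq hη hη2 hη' hη2').choose⟩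

/-- The double covers branched along a squarefree equation of even class are those given by its
square root. -/
lemma DoubleCover.branchLocus_eq_iff {d : ℕ} {H : Cox} {n : ℕ × ℕ} (hH : IsHomog d H (n + n))
    (hsq : Squarefree H) (Z : DoubleCover) :
    Z.branchLocus d = {p | MvPolynomial.eval p.coord H = 0} ↔ Z.IsSqrtOf H := by
  refine ⟨fun hB => ?_, fun h => h.branchLocus_eq hH hsq⟩
  obtain ⟨m, H', hH', hsq', hZ⟩ := Z.exists_isSqrtOf d
  rw [hZ.branchLocus_eq hH' hsq', Set.ext_iff] at hB
  exact hZ.of_associated (associated_of_dvd_dvd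
    (dvd_of_zeros_subset hsq' fun p hp => (hB p).1 hp)
    (dvd_of_zeros_subset hsq fun p hp => (hB p).2 hp))

/-- There is exactly one double cover branched along a squarefree equation of even class. -/
lemma hasUniqueDoubleCover {d : ℕ} {H : Cox} {n : ℕ × ℕ} (hH : IsHomog d H (n + n))
    (hsq : Squarefree H) (hu : ¬ IsUnit H) :
    HasUniqueDoubleCover d {p | MvPolynomial.eval p.coord H = 0} := by
  obtain ⟨Z, hZ⟩ := exists_doubleCover_isSqrtOf hH hsq hu
  exact ⟨Z, (Z.branchLocus_eq_iff hH hsq).2 hZ, fun Z' hZ' =>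
    hZ.iso ((Z'.branchLocus_eq_iff hH hsq).1 hZ')⟩

/-! ### Affine equations of multisections disjoint from the negative section -/

lemma X_dvd_of_coeff_eq_zero {σ R : Type*} [CommRing R] {i : σ} {a : MvPolynomial σ R}
    (h : ∀ m : σ →₀ ℕ, m i = 0 → a.coeff m = 0) : MvPolynomial.X i ∣ a := by
  rw [MvPolynomial.X_dvd_iff_modMonomial_eq_zero]
  ext m
  by_cases hm : Finsupp.single i 1 ≤ m
  · rw [MvPolynomial.coeff_modMonomial_of_le _ hm, MvPolynomial.coeff_zero]
  · rw [MvPolynomial.coeff_modMonomial_of_not_le _ hm, MvPolynomial.coeff_zero]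
    apply h
    by_contra h0
    exact hm (Finsupp.single_le_iff.2 (Nat.one_le_iff_ne_zero.2 h0))

lemma Curve.cls_eq_of_associated {d : ℕ} {C D : Curve d} (h : Associated C.eqn D.eqn) :
    C.cls = D.cls := by
  obtain ⟨u, hu⟩ := h
  obtain ⟨c, -, hc⟩ := MvPolynomial.isUnit_iff_eq_C_of_isReduced.1 u.isUnit
  refine C.homogeneous.inj_right C.irreducible.ne_zero ?_
  have hc0 : c ≠ 0 := by
    rintro rfl
    rw [map_zero] at hc
    exact u.ne_zero hc
  have : C.eqn = MvPolynomial.C c⁻¹ * D.eqn := by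
    rw [← hu, hc, mul_left_comm, ← MvPolynomial.C_mul, inv_mul_cancel₀ hc0, MvPolynomial.C_1,
      mul_one]
  rw [this]
  exact D.homogeneous.C_mul _

section

variable {d n : ℕ} (hd : 0 < d) (hn : 0 < n) {C : Curve d} (hC : C.cls = (n * d, n))

include hd hn hC

lemma Curve.not_associated_X {i : Fin 4} (hi : weight d i = (1, 0) ∨ weight d i = (0, 1)) :
    ¬ Associated C.eqn (MvPolynomial.X i) := by
  intro h
  let D : Curve d :=
    ⟨MvPolynomial.X i, weight d i, MvPolynomial.X_prime.irreducible, isHomog_X d i⟩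
  have hcls : C.cls = weight d i := Curve.cls_eq_of_associated (D := D) h
  rw [hC] at hcls
  have hnd : 0 < n * d := Nat.mul_pos hn hd
  rcases hi with hi | hi <;> rw [hi, Prod.ext_iff] at hcls <;> simp only at hcls <;> omega

/-- The coefficient of `u ^ n` is a non-zero constant: it is a constant for reasons of degree, and if it
were zero, then `Δ₀` would be a component of `C`. -/
lemma Curve.coeff_affine_ne_zero :
    ∃ a : ℂ, a ≠ 0 ∧ (affine C.eqn).coeff n = Polynomial.C a := by
  have hhom : IsHomog d C.eqn (n * d, n) := hC ▸ C.homogeneous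
  refine ⟨C.eqn.coeff (Finsupp.single 2 n), fun h0 => ?_, ?_⟩
  · refine Curve.not_associated_X hd hn hC (i := 3) (Or.inr rfl) ?_
    refine (MvPolynomial.X_prime.irreducible.associated_of_dvd C.irreducible
      (X_dvd_of_coeff_eq_zero fun m hm => ?_)).symm
    by_contra hne
    have hw := hhom hne
    rw [weight_eq, Prod.ext_iff] at hw
    simp only [hm, add_zero] at hw
    have h2 := hw.2
    have h1 := hw.1
    rw [h2, mul_comm d n] at h1
    apply hne
    rw [show m = Finsupp.single 2 n from ?_]
    · exact h0
    ext i
    fin_cases i <;> simp <;> omega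
  · ext j
    rw [coeff_C]
    split_ifs with hj
    · subst hj
      have := coeff_coeff_affine hhom (Finsupp.single 2 n) (by rw [weight_eq]; simp [mul_comm])
      simpa using this
    · by_contra hne
      have := (coeff_coeff_affine_ne_zero hhom hne).1
      rw [mul_comm n d] at this
      simp only at this
      omega

/-- Divisibility by the equation of `C` can be tested on the affine chart, because `C` is none of the
curves `s = 0`, `v = 0` at its boundary. -/
lemma Curve.dvd_iff_affine_dvd {b : Cox} {k : ℕ × ℕ} (hb : IsHomog d b k) :
    C.eqn ∣ b ↔ affine C.eqn ∣ affine b := by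
  refine ⟨map_dvd affine, ?_⟩
  rintro ⟨q, hq⟩
  obtain ⟨m, l, hml⟩ := exists_homogenization d q
  obtain ⟨Q, hQ, hQ'⟩ := hml (m + k.1) (l + k.2) (Nat.le_add_right _ _) (Nat.le_add_right _ _)
  have key : b * (MvPolynomial.X 0 ^ (m + C.cls.1) * MvPolynomial.X 3 ^ (l + C.cls.2)) =
      C.eqn * Q := by
    refine eq_of_affine_eq (d := d) ?_ (C.homogeneous.mul hQ) ?_
    · convert hb.mul (((isHomog_X d 0).pow (m + C.cls.1)).mul
        ((isHomog_X d 3).pow (l + C.cls.2))) using 1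
      ext <;> simp [weight] <;> ring
    · simp [hq, hQ']
  have hp := C.irreducible.prime
  have hX : ∀ i (j : ℕ), (weight d i = (1, 0) ∨ weight d i = (0, 1)) →
      ¬ C.eqn ∣ MvPolynomial.X i ^ j := fun i j hi h =>
    Curve.not_associated_X hd hn hC hi
      (C.irreducible.associated_of_dvd MvPolynomial.X_prime.irreducible (hp.dvd_of_dvd_pow h))
  refine (hp.dvd_or_dvd (Dvd.intro _ key.symm)).resolve_right fun h => ?_
  exact (hp.dvd_or_dvd h).elim (hX 0 _ (Or.inl rfl)) (hX 3 _ (Or.inr rfl))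

/-- The affine equation of a curve of class `n (Δ₀ + d F)` is, up to a constant, a monic prime
polynomial of degree `n` in `u`. -/
lemma Curve.exists_monic : ∃ (a : ℂ) (F : ℂ[X][X]), a ≠ 0 ∧ F.Monic ∧ F.natDegree = n ∧ Prime F ∧
    affine C.eqn = Polynomial.C (Polynomial.C a) * F ∧
    ∀ (b : Cox) (k : ℕ × ℕ), IsHomog d b k → (C.eqn ∣ b ↔ F ∣ affine b) := by
  obtain ⟨a, ha, hcoeff⟩ := Curve.coeff_affine_ne_zero hd hn hC
  have hhom : IsHomog d C.eqn (n * d, n) := hC ▸ C.homogeneous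
  have hdeg : (affine C.eqn).natDegree ≤ n := by
    rw [natDegree_le_iff_coeff_eq_zero]
    intro k hk
    ext j
    by_contra hne
    have := (coeff_coeff_affine_ne_zero hhom hne).2
    simp only at this
    omega
  have hu : IsUnit (Polynomial.C (Polynomial.C a) : ℂ[X][X]) :=
    ((IsUnit.mk0 a ha).map Polynomial.C).map Polynomial.C
  set F := Polynomial.C (Polynomial.C a⁻¹) * affine C.eqn with hF
  have haF : affine C.eqn = Polynomial.C (Polynomial.C a) * F := by
    rw [hF, ← mul_assoc, ← map_mul, ← map_mul, mul_inv_cancel₀ ha, map_one, map_one, one_mul]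
  have hdvd : ∀ x : ℂ[X][X], affine C.eqn ∣ x ↔ F ∣ x := fun x => by
    rw [haF, hu.mul_left_dvd]
  have hFn : F.coeff n = 1 := by
    rw [hF, coeff_C_mul, hcoeff, ← map_mul, inv_mul_cancel₀ ha, map_one]
  have hFdeg : F.natDegree = n := le_antisymm
    ((natDegree_C_mul_le _ _).trans hdeg) (le_natDegree_of_ne_zero (by rw [hFn]; exact one_ne_zero))
  have hmonic : F.Monic := by rw [Monic, leadingCoeff, hFdeg, hFn]
  refine ⟨a, F, ha, hmonic, hFdeg, ⟨hmonic.ne_zero, fun h => ?_, fun p q hpq => ?_⟩, haF,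
    fun b k hb => (Curve.dvd_iff_affine_dvd hd hn hC hb).trans (hdvd _)⟩
  · have := natDegree_eq_zero_of_isUnit h
    omega
  · obtain ⟨_, P, _, hP, -, rfl, -⟩ := exists_homogenization₂ d p 0
    obtain ⟨_, Q, _, hQ, -, rfl, -⟩ := exists_homogenization₂ d q 0
    rw [← map_mul, ← hdvd, ← Curve.dvd_iff_affine_dvd hd hn hC (hP.mul hQ)] at hpq
    rw [← hdvd, ← hdvd, ← Curve.dvd_iff_affine_dvd hd hn hC hP,
      ← Curve.dvd_iff_affine_dvd hd hn hC hQ]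
    exact C.irreducible.prime.dvd_or_dvd hpq

/-- The equation of `Δ₀ + C` is squarefree. -/
lemma Curve.squarefree_X_mul : Squarefree (MvPolynomial.X 3 * C.eqn) := by
  rw [squarefree_mul_iff]
  refine ⟨?_, MvPolynomial.X_prime.irreducible.squarefree, C.irreducible.squarefree⟩
  rw [MvPolynomial.X_prime.irreducible.isRelPrime_iff_not_dvd]
  exact fun h => Curve.not_associated_X hd hn hC (i := 3) (Or.inr rfl)
    (MvPolynomial.X_prime.irreducible.associated_of_dvd C.irreducible h).symm

end

lemma negSection_points_union {d : ℕ} (C : Curve d) : (negSection d).points ∪ C.points =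
    {p | MvPolynomial.eval p.coord (MvPolynomial.X 3 * C.eqn) = 0} := by
  ext p
  simp only [Curve.points, negSection, Set.mem_union, Set.mem_ofPred_eq, map_mul, mul_eq_zero]

lemma not_isUnit_X_mul (a : Cox) : ¬ IsUnit (MvPolynomial.X 3 * a) := fun h =>
  MvPolynomial.X_prime.not_isUnit (isUnit_of_mul_isUnit_left h)

lemma dehom_X_mul (a : Cox) : dehom (MvPolynomial.X 3 * a) = toFunField (affine a) := by
  rw [dehom_eq, map_mul, affine_X_three, one_mul]

/-! ### The generic fibre of the elliptic fibration -/

lemma ruling_algebraMap (p : ℂ[X]) : ruling (algebraMap ℂ[X] (RatFunc ℂ) p) = aeval tFun p := by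
  have h := RatFunc.liftAlgHom_apply_div (L := FunField) (aeval tFun)
    (nonZeroDivisors_le_comap_nonZeroDivisors_of_injective _ tFun_transcendental) p 1
  rw [map_one, map_one, div_one, div_one] at h
  exact h

section

variable {d : ℕ} {Γ : Curve d} {a : ℂ} {F : ℂ[X][X]} (ha : a ≠ 0) (hF : F.Monic)
  (hdeg : F.natDegree = 3) (haF : affine Γ.eqn = C (C a) * F)

include ha hF hdeg haF

lemma monicCoeff_eq (k : ℕ) : Γ.monicCoeff k = algebraMap ℂ[X] (RatFunc ℂ) (F.coeff k) := by
  have h3 : F.coeff 3 = 1 := by rw [← hdeg]; exact hF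
  have hCa : algebraMap ℂ[X] (RatFunc ℂ) (C a) ≠ 0 := by
    simpa using ha
  change algebraMap ℂ[X] (RatFunc ℂ) ((affine Γ.eqn).coeff k) /
    algebraMap ℂ[X] (RatFunc ℂ) ((affine Γ.eqn).coeff 3) = _
  rw [haF, coeff_C_mul, coeff_C_mul, h3, mul_one, map_mul, mul_div_cancel_left₀ _ hCa]

/-- The double cover branched along `Δ₀ + Γ` has the Weierstrass curve of `Γ` as its generic fibre; a
square root of the constant leading coefficient makes the equation monic. -/
lemma hasGenericFibre {S : DoubleCover} (hS : S.IsSqrtOf (MvPolynomial.X 3 * Γ.eqn)) :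
    S.HasGenericFibre (genericFibre Γ) := by
  obtain ⟨η, hη, hη2⟩ := hS
  obtain ⟨b, hb⟩ := IsAlgClosed.exists_pow_nat_eq a two_pos
  have hb0 : algebraMap ℂ FunField b ≠ 0 := by
    rw [Ne, map_eq_zero]; rintro rfl; exact ha (by rw [← hb]; simp)
  refine ⟨η * algebraMap _ _ (algebraMap ℂ FunField b)⁻¹, ?_,
    QuadraticExtension.adjoin_eq_top S.finrank_eq (mul_algebraMap_notMem hη (inv_ne_zero hb0))⟩
  have hFu : toFunField F = uFun ^ 3 + aeval tFun (F.coeff 2) * uFun ^ 2 +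
      aeval tFun (F.coeff 1) * uFun + aeval tFun (F.coeff 0) := by
    have h3 : F.coeff 3 = 1 := by rw [← hdeg]; exact hF
    conv_lhs => rw [F.as_sum_range_C_mul_X_pow, hdeg]
    simp only [Finset.sum_range_succ, Finset.sum_range_zero, h3, map_add, map_mul, map_pow,
      toFunField_C, toFunField_X, map_one, map_zero]
    ring
  have hsq : (η * algebraMap FunField S.field (algebraMap ℂ FunField b)⁻¹) ^ 2 =
      algebraMap FunField S.field (toFunField F) := by
    rw [mul_pow, hη2, dehom_X_mul, haF, ← map_pow, ← map_mul, map_mul toFunField, toFunField_C,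
      aeval_C, ← hb, map_pow]
    congr 1
    field_simp
  rw [WeierstrassCurve.Affine.equation_iff]
  have hr : ∀ k, ((algebraMap FunField S.field).comp ruling.toRingHom) (Γ.monicCoeff k) =
      algebraMap FunField S.field (aeval tFun (F.coeff k)) := fun k => by
    rw [monicCoeff_eq ha hF hdeg haF, RingHom.comp_apply]
    exact congrArg _ (ruling_algebraMap _)
  simp only [genericFibre, WeierstrassCurve.map, WeierstrassCurve.toAffine, hr, map_zero, hsq, hFu,
    map_add, map_mul, map_pow]
  ring

end

end Hirzebruch

/-! ### Divisibility by two on an elliptic curve without rational two-torsion -/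

namespace WeierstrassCurve.Affine

variable {K : Type*} [Field K] {W : WeierstrassCurve.Affine K}

variable (W) in
/-- The cubic on the right hand side of the equation `y² = u³ + a₂ u² + a₄ u + a₆`. -/
def cubicPoly : K[X] := X ^ 3 + C W.a₂ * X ^ 2 + C W.a₄ * X + C W.a₆

lemma natDegree_cubicPoly : W.cubicPoly.natDegree = 3 := by
  rw [cubicPoly]; compute_degree!

lemma eval_cubicPoly (x : K) : W.cubicPoly.eval x = x ^ 3 + W.a₂ * x ^ 2 + W.a₄ * x + W.a₆ := by
  simp [cubicPoly]

lemma eval_cubicPoly_ne_zero (hirr : Irreducible W.cubicPoly) (x : K) :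
    W.cubicPoly.eval x ≠ 0 := fun h => by
  have := degree_eq_one_of_irreducible_of_root hirr h
  rw [degree_eq_natDegree hirr.ne_zero, natDegree_cubicPoly] at this
  norm_num at this

lemma eq_zero_of_cubicPoly_dvd {r s t : K}
    (h : W.cubicPoly ∣ C r + C s * X + C t * X ^ 2) : r = 0 ∧ s = 0 ∧ t = 0 := by
  have h0 : C r + C s * X + C t * X ^ 2 = 0 := by
    refine eq_zero_of_dvd_of_natDegree_lt h ?_
    rw [natDegree_cubicPoly]
    refine lt_of_le_of_lt (?_ : _ ≤ 2) (by norm_num)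
    compute_degree
  refine ⟨?_, ?_, ?_⟩
  · simpa using congrArg (coeff · 0) h0
  · simpa [coeff_X, coeff_C] using congrArg (coeff · 1) h0
  · simpa [coeff_X, coeff_C] using congrArg (coeff · 2) h0

variable (ha₁ : W.a₁ = 0) (ha₃ : W.a₃ = 0)

include ha₁ ha₃

lemma equation_iff_eval_cubicPoly (x y : K) : W.Equation x y ↔ y ^ 2 = W.cubicPoly.eval x := by
  rw [equation_iff, eval_cubicPoly, ha₁, ha₃]
  simp

lemma negY_eq_neg (x y : K) : W.negY x y = -y := by
  rw [negY, ha₁, ha₃]; ring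

lemma nonsingular_of_ne_zero [CharZero K] {x y : K} (h : y ^ 2 = W.cubicPoly.eval x)
    (hy : y ≠ 0) : W.Nonsingular x y := by
  rw [nonsingular_iff]
  refine ⟨(equation_iff_eval_cubicPoly ha₁ ha₃ x y).2 h, Or.inr ?_⟩
  rw [ha₁, ha₃]
  intro h0
  exact hy (self_eq_neg.1 (by simpa using h0))

lemma addPolynomial_eq_sub (x y ℓ : K) :
    W.addPolynomial x y ℓ = linePolynomial x y ℓ ^ 2 - W.cubicPoly := by
  rw [addPolynomial, polynomial, ha₁, ha₃, cubicPoly]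
  simp

/-- Two-descent: if the cubic `f` is irreducible, then a point `(x, y)` is divisible by `2` if and
only if `x - θ` is a square in `K[θ] = K[X] / (f)`. In one direction, the tangent at a half of
the point exhibits the square root. In the other direction, a square root of `x - θ` is the quotient of
two elements that are linear in `θ`, and these give the tangent line and its point of contact. -/
theorem exists_eq_two_nsmul_iff [CharZero K] [DecidableEq K] (hirr : Irreducible W.cubicPoly)
    {x y : K} (h : W.Nonsingular x y) :
    (∃ s : W.Point, Point.some x y h = 2 • s) ↔ ∃ A : K[X], W.cubicPoly ∣ A ^ 2 - (C x - X) := by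
  have hne : ∀ {x₁ y₁ : K}, y₁ ^ 2 = W.cubicPoly.eval x₁ → y₁ ≠ W.negY x₁ y₁ := by
    intro x₁ y₁ h1 h0
    rw [negY_eq_neg ha₁ ha₃, self_eq_neg] at h0
    rw [h0] at h1
    exact eval_cubicPoly_ne_zero hirr x₁ (by rw [← h1]; ring)
  constructor
  · rintro ⟨s, hs⟩
    rcases s with _ | ⟨x₁, y₁, h1⟩
    · exact absurd (hs.trans (nsmul_zero 2)) (Point.some_ne_zero h)
    have heq := (equation_iff_eval_cubicPoly ha₁ ha₃ x₁ y₁).1 h1.1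
    have hy := hne heq
    rw [two_nsmul, Point.add_self_of_Y_ne hy, Point.some.injEq] at hs
    have key := addPolynomial_slope h1.1 h1.1 fun hxy => hy hxy.2
    rw [← hs.1, addPolynomial_eq_sub ha₁ ha₃] at key
    have hcop : IsCoprime W.cubicPoly (X - C x₁) := by
      rw [hirr.coprime_iff_not_dvd]
      intro hd
      have := natDegree_le_of_dvd hd (X_sub_C_ne_zero x₁)
      rw [natDegree_cubicPoly, natDegree_X_sub_C] at this
      omega
    obtain ⟨u, v, huv⟩ := hcop
    set ℓ := linePolynomial x₁ y₁ (W.slope x₁ x₁ y₁ y₁)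
    refine ⟨v * ℓ, v ^ 2 - (C x - X) * u * (1 + v * (X - C x₁)), ?_⟩
    linear_combination v ^ 2 * key + (C x - X) * (1 + v * (X - C x₁)) * huv
  · rintro ⟨A, hA⟩
    have hmonic : W.cubicPoly.Monic := by rw [cubicPoly]; monicity!
    obtain ⟨a, b, c, habc⟩ : ∃ a b c : K,
        W.cubicPoly ∣ A - (C a + C b * X + C c * X ^ 2) := by
      have hdeg : (A %ₘ W.cubicPoly).natDegree < 3 := by
        rw [← natDegree_cubicPoly (W := W)]
        refine natDegree_modByMonic_lt _ hmonic fun h1 => ?_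
        have := natDegree_cubicPoly (W := W)
        rw [h1, natDegree_one] at this
        omega
      refine ⟨(A %ₘ W.cubicPoly).coeff 0, (A %ₘ W.cubicPoly).coeff 1,
        (A %ₘ W.cubicPoly).coeff 2, A /ₘ W.cubicPoly, ?_⟩
      have h1 := as_sum_range_C_mul_X_pow' _ hdeg
      rw [Finset.sum_range_succ, Finset.sum_range_succ, Finset.sum_range_one, pow_zero, pow_one,
        mul_one] at h1
      rw [← h1]
      linear_combination (modByMonic_add_div A W.cubicPoly).symm
    have hsq : W.cubicPoly ∣ (C a + C b * X + C c * X ^ 2) ^ 2 - (C x - X) := by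
      have := dvd_sub hA (habc.mul_right (A + (C a + C b * X + C c * X ^ 2)))
      convert this using 1; ring
    have hc : c ≠ 0 := by
      rintro rfl
      have : W.cubicPoly ∣ C (a ^ 2 - x) + C (2 * a * b + 1) * X + C (b ^ 2) * X ^ 2 := by
        convert hsq using 1
        simp only [map_sub, map_add, map_mul, map_pow, map_zero, map_one, map_ofNat]; ring
      obtain ⟨-, h1, h2⟩ := eq_zero_of_cubicPoly_dvd this
      rw [pow_eq_zero_iff two_ne_zero |>.1 h2] at h1
      simp at h1
    -- `(a + b θ + c θ²) (e - c θ) = p + q θ`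
    obtain ⟨e, he⟩ : ∃ e, e = b - W.a₂ * c := ⟨_, rfl⟩
    obtain ⟨p, hp⟩ : ∃ p, p = a * e + c ^ 2 * W.a₆ := ⟨_, rfl⟩
    obtain ⟨q, hq⟩ : ∃ q, q = b * e - a * c + c ^ 2 * W.a₄ := ⟨_, rfl⟩
    have hlin : (C a + C b * X + C c * X ^ 2) * (C e - C c * X) =
        C p + C q * X - C (c ^ 2) * W.cubicPoly := by
      rw [hp, hq, cubicPoly, he]
      simp only [map_sub, map_add, map_mul, map_pow]; ring
    have hD : W.cubicPoly ∣ C (p ^ 2 - x * e ^ 2 - c ^ 2 * W.a₆) +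
        C (2 * p * q + 2 * x * e * c + e ^ 2 - c ^ 2 * W.a₄) * X +
        C (q ^ 2 - x * c ^ 2 - 2 * e * c - c ^ 2 * W.a₂) * X ^ 2 := by
      have h1 : W.cubicPoly ∣ (C p + C q * X) ^ 2 - (C x - X) * (C e - C c * X) ^ 2 -
          C (c ^ 2) * W.cubicPoly := by
        obtain ⟨g, hg⟩ := hsq
        refine ⟨g * (C e - C c * X) ^ 2 - C (c ^ 2) + C (c ^ 2) *
          (C p + C q * X + (C a + C b * X + C c * X ^ 2) * (C e - C c * X)), ?_⟩
        linear_combination (C e - C c * X) ^ 2 * hg - (C p + C q * X +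
          (C a + C b * X + C c * X ^ 2) * (C e - C c * X)) * hlin
      convert h1 using 1
      rw [cubicPoly]
      simp only [map_sub, map_add, map_mul, map_pow, map_ofNat]; ring
    obtain ⟨e0, e1, e2⟩ := eq_zero_of_cubicPoly_dvd hD
    -- the point of contact of the line `Y = (p + q X) / c`
    obtain ⟨x₁, hx₁⟩ : ∃ x₁, x₁ = e / c := ⟨_, rfl⟩
    obtain ⟨y₁, hy₁⟩ : ∃ y₁, y₁ = (p + q * x₁) / c := ⟨_, rfl⟩
    have he' : e = x₁ * c := by rw [hx₁, div_mul_cancel₀ _ hc]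
    have hpq : p = c * y₁ - q * x₁ := by rw [hy₁]; field
    rw [hpq, he'] at e0 e1
    rw [he'] at e2
    have hf1 : y₁ ^ 2 = W.cubicPoly.eval x₁ := by
      rw [eval_cubicPoly]
      apply mul_left_cancel₀ (pow_ne_zero 2 hc)
      linear_combination e0 + x₁ * e1 + x₁ ^ 2 * e2
    have hy := hne hf1
    have hy0 : y₁ ≠ 0 := by
      rintro rfl; exact hy (by rw [negY_eq_neg ha₁ ha₃, neg_zero])
    have h1 := nonsingular_of_ne_zero ha₁ ha₃ hf1 hy0
    have hslope : W.slope x₁ x₁ y₁ y₁ = q / c := by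
      rw [slope_of_Y_ne rfl hy, negY_eq_neg ha₁ ha₃, ha₁, div_eq_div_iff (by
        rw [sub_neg_eq_add, ← two_mul]; exact mul_ne_zero two_ne_zero hy0) hc]
      apply mul_left_cancel₀ hc
      linear_combination -e1 - 2 * x₁ * e2
    have hx : W.addX x₁ x₁ (W.slope x₁ x₁ y₁ y₁) = x := by
      rw [addX, hslope, ha₁]
      field_simp
      linear_combination e2
    have h2 := Point.add_self_of_Y_ne (h₁ := h1) hy
    rw [← two_nsmul] at h2
    rcases (Point.X_eq_iff (h₁ := h) (h₂ := nonsingular_add h1 h1 fun hxy => hy hxy.2)).1 hx.symm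
      with h3 | h3
    · exact ⟨Point.some x₁ y₁ h1, by rw [h2, h3]⟩
    · exact ⟨-Point.some x₁ y₁ h1, by rw [smul_neg, h2, h3]⟩

end WeierstrassCurve.Affine

namespace Hirzebruch

/-! ### Intersection multiplicities with a section -/

/-- The point of the curve `u = x(t)` over `t = τ`. -/
def graphPt (x : ℂ[X]) (τ : ℂ) : Pt where
  coord := ![1, τ, x.eval τ, 1]
  base_ne := Or.inl one_ne_zero
  fibre_ne := Or.inr one_ne_zero

lemma eval_graphPt (x : ℂ[X]) (τ : ℂ) (a : Cox) :
    MvPolynomial.eval (graphPt x τ).coord a = ((affine a).eval x).eval τ := by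
  induction a using MvPolynomial.induction_on with
  | C r =>
    rw [MvPolynomial.eval_C, ← MvPolynomial.algebraMap_eq, AlgHom.commutes]
    simp [Polynomial.algebraMap_apply]
  | add p q hp hq => simp only [map_add, eval_add, hp, hq]
  | mul_X p i hp =>
    rw [map_mul, map_mul, hp, eval_mul, eval_mul]
    congr 1
    fin_cases i <;> simp [graphPt]

section

variable {d : ℕ} {x : ℂ[X]} {τ : ℂ}

lemma mem_prime_graphPt_iff {a : Cox} :
    a ∈ (graphPt x τ).prime ↔ ((affine a).eval x).eval τ = 0 := by
  rw [← eval_graphPt]; rfl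

lemma toFunField_mem (a : ℂ[X][X]) : toFunField a ∈ (graphPt x τ).localRing d := by
  obtain ⟨n, A, B, hA, hB, rfl, hB1⟩ := exists_homogenization₂ d a 1
  refine ⟨n, A, B, hA, hB, ?_, ?_⟩
  · rw [mem_prime_graphPt_iff, hB1]; simp
  · rw [dehom_eq, dehom_eq, hB1, map_one, mul_one]

variable (d x τ) in
/-- The inclusion of `ℂ[t, u]` into the local ring at a point of the affine chart. -/
def toLocalRing : ℂ[X][X] →ₐ[ℂ] (graphPt x τ).localRing d :=
  toFunField.codRestrict _ toFunField_mem

lemma isUnit_toLocalRing {b : ℂ[X][X]} (hb : (b.eval x).eval τ ≠ 0) :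
    IsUnit (toLocalRing d x τ b) := by
  obtain ⟨n, A, B, hA, hB, rfl, hB1⟩ := exists_homogenization₂ d b 1
  rw [isUnit_localRing_iff _ hA hB, mem_prime_graphPt_iff]
  · exact hb
  · rw [mem_prime_graphPt_iff, hB1]; simp
  · rw [dehom_eq, dehom_eq, hB1, map_one, mul_one]; rfl

lemma toLocalRing_mem_ideal (C : Curve d) {a : ℂ[X][X]} (ha : affine C.eqn ∣ a) :
    toLocalRing d x τ a ∈ C.ideal (graphPt x τ).prime := by
  obtain ⟨q, rfl⟩ := ha
  obtain ⟨n, A, B, hA, hB, rfl, hB1⟩ := exists_homogenization₂ d q 1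
  refine ⟨_, C.eqn * A,
    (MvPolynomial.X 0 ^ C.cls.1 * MvPolynomial.X 3 ^ C.cls.2) * B, C.homogeneous.mul hA,
    ?_, ?_, Dvd.intro _ rfl, ?_⟩
  · convert (((isHomog_X d 0).pow C.cls.1).mul ((isHomog_X d 3).pow C.cls.2)).mul hB using 1
    ext <;> simp [weight]
  · rw [mem_prime_graphPt_iff]; simp [hB1]
  · change toFunField _ * _ = _
    simp [dehom_eq, hB1]

/-- If a polynomial in `t` lies in the ideal of the intersection of `C` and `D`, then the equation of `D`
restricted to `u = x(t)` divides it up to a denominator that does not vanish at `τ`. -/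
lemma exists_eval_dvd_mul {C D : Curve d} (hC : (affine C.eqn).eval x = 0) {q : ℂ[X]}
    (hq : toLocalRing d x τ (Polynomial.C q) ∈
      C.ideal (graphPt x τ).prime ⊔ D.ideal (graphPt x τ).prime) :
    ∃ b : ℂ[X], b.eval τ ≠ 0 ∧ (affine D.eqn).eval x ∣ q * b := by
  obtain ⟨α, ⟨n, a, b, -, -, hb, ⟨g, hg⟩, hα⟩, β, ⟨n', a', b', -, -, hb', ⟨g', hg'⟩, hβ⟩, hαβ⟩ :=
    Submodule.mem_sup.1 hq
  have hαβ' : (α : FunField) + β = toFunField (Polynomial.C q) := congrArg Subtype.val hαβ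
  have h1 : Polynomial.C q * (affine b * affine b') =
      affine a * affine b' + affine a' * affine b := by
    apply toFunField_injective
    simp only [dehom_eq] at hα hβ
    simp only [map_mul, map_add]
    rw [← hαβ', ← hα, ← hβ]
    ring
  have h2 := congrArg (eval x) h1
  rw [hg, hg'] at h2
  simp only [eval_mul, eval_add, eval_C, map_mul, hC, zero_mul, zero_add] at h2
  rw [mem_prime_graphPt_iff] at hb hb'
  refine ⟨(affine b).eval x * (affine b').eval x, ?_, ?_⟩
  · rw [eval_mul]
    exact mul_ne_zero hb hb'
  · rw [h2, mul_assoc]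
    exact Dvd.intro _ rfl

/-- The intersection multiplicity at a point of the curve `u = x(t)` with another curve is the
order of vanishing of the equation of the latter, restricted to the former. -/
lemma intersectionMult_graphPt {C D : Curve d} {c : ℂ} (hc : c ≠ 0)
    (hC : affine C.eqn = Polynomial.C (Polynomial.C c) * (X - Polynomial.C x))
    (hD : (affine D.eqn).eval x ≠ 0) :
    intersectionMult C D (graphPt x τ) = ((affine D.eqn).eval x).rootMultiplicity τ := by
  set N := (affine D.eqn).eval x with hN
  set k := N.rootMultiplicity τ with hk
  set R := (graphPt x τ).localRing d
  set I : Ideal R := C.ideal (graphPt x τ).prime ⊔ D.ideal (graphPt x τ).prime with hI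
  let ι := toLocalRing d x τ
  have hCu : ∀ a : ℂ[X][X], a.eval x = 0 → affine C.eqn ∣ a := by
    intro a ha
    have hu : IsUnit (Polynomial.C (Polynomial.C c) : ℂ[X][X]) :=
      ((IsUnit.mk0 c hc).map Polynomial.C).map Polynomial.C
    rw [hC, hu.mul_left_dvd]
    exact dvd_iff_isRoot.2 ha
  have hgraph : ∀ a : ℂ[X][X], ι (a - Polynomial.C (a.eval x)) ∈ I := fun a =>
    Ideal.mem_sup_left (toLocalRing_mem_ideal C (hCu _ (by simp)))
  have hNI : ι (Polynomial.C N) ∈ I := by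
    have h1 := sub_mem (Ideal.mem_sup_right (toLocalRing_mem_ideal D dvd_rfl) :
      ι (affine D.eqn) ∈ I) (hgraph (affine D.eqn))
    rwa [← map_sub, sub_sub_cancel] at h1
  have hpow : ι (Polynomial.C ((X - Polynomial.C τ) ^ k)) ∈ I := by
    obtain ⟨w, hw, hwτ⟩ := exists_eq_pow_rootMultiplicity_mul_and_not_dvd N hD τ
    rw [hw, map_mul, map_mul] at hNI
    refine (Ideal.mul_unit_mem_iff_mem _ (isUnit_toLocalRing ?_)).1 hNI
    rw [eval_C]
    exact fun h => hwτ (dvd_iff_isRoot.2 h)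
  -- the polynomials in `t` map onto the ring of the intersection, with kernel `((t - τ) ^ k)`
  let φ : ℂ[X] →ₐ[ℂ] (R ⧸ I) := (Ideal.Quotient.mkₐ ℂ I).comp (ι.comp CAlgHom)
  have hφ : ∀ q, φ q = Ideal.Quotient.mk I (ι (Polynomial.C q)) := fun q => rfl
  have hcop : ∀ b : ℂ[X], b.eval τ ≠ 0 → IsCoprime ((X - Polynomial.C τ) ^ k) b := by
    intro b hb
    refine IsCoprime.pow_left ((irreducible_X_sub_C τ).coprime_iff_not_dvd.2 fun h => hb ?_)
    exact dvd_iff_isRoot.1 h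
  have hker : RingHom.ker φ = Ideal.span {(X - Polynomial.C τ) ^ k} := by
    ext q
    rw [RingHom.mem_ker, hφ, Ideal.Quotient.eq_zero_iff_mem, Ideal.mem_span_singleton]
    constructor
    · intro hq
      obtain ⟨b, hb, hdvd⟩ := exists_eval_dvd_mul (by rw [hC]; simp) hq
      exact (hcop b hb).dvd_of_dvd_mul_right ((N.pow_rootMultiplicity_dvd τ).trans hdvd)
    · rintro ⟨g, rfl⟩
      rw [map_mul, map_mul]
      exact Ideal.mul_mem_right _ _ hpow
  have hsurj : Function.Surjective φ := by
    intro z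
    obtain ⟨z, rfl⟩ := Ideal.Quotient.mk_surjective z
    obtain ⟨n, a, b, -, -, hb, hz⟩ := z.2
    rw [mem_prime_graphPt_iff] at hb
    obtain ⟨u, v, huv⟩ := hcop _ hb
    refine ⟨v * (affine a).eval x, ?_⟩
    rw [hφ, eq_comm, Ideal.Quotient.eq]
    refine (Ideal.unit_mul_mem_iff_mem _ (isUnit_toLocalRing hb)).1 ?_
    have hz' : ι (affine b) * z = ι (affine a) := by
      apply Subtype.ext
      change toFunField (affine b) * (z : FunField) = toFunField (affine a)
      rw [← dehom_eq, ← dehom_eq, ← hz, mul_comm]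
    change ι (affine b) * (z - ι _) ∈ I
    rw [mul_sub, hz']
    have h1 := sub_mem (hgraph (affine a)) (I.mul_mem_right
      (ι (Polynomial.C (v * (affine a).eval x))) (hgraph (affine b)))
    have h2 := add_mem h1 (I.mul_mem_right (ι (Polynomial.C (u * (affine a).eval x))) hpow)
    convert h2 using 1
    have h3 := congrArg (fun q => ι (Polynomial.C q)) huv
    simp only [map_add, map_mul, map_one, map_sub] at h3 ⊢
    linear_combination -ι (Polynomial.C ((affine a).eval x)) * h3
  have e := (Ideal.quotientEquivAlgOfEq ℂ hker).symm.trans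
    (Ideal.quotientKerAlgEquivOfSurjective hsurj)
  have := e.toLinearEquiv.finrank_eq
  rw [finrank_quotient_span_eq_natDegree, natDegree_pow, natDegree_X_sub_C, mul_one] at this
  exact this.symm

end

lemma isSquare_of_even_rootMultiplicity {N : ℂ[X]} (h : ∀ τ, Even (N.rootMultiplicity τ)) :
    IsSquare N := by
  classical
  rw [(IsAlgClosed.splits N).eq_prod_roots]
  refine IsSquare.mul ?_ ?_
  · obtain ⟨z, hz⟩ := IsAlgClosed.exists_pow_nat_eq N.leadingCoeff two_pos
    exact ⟨C z, by rw [← hz, ← C_mul, sq]⟩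
  · rw [Finset.prod_multiset_map_count]
    refine Finset.isSquare_prod _ fun τ _ => ?_
    rw [count_roots]
    exact (h τ).isSquare_pow _

/-- The restriction of the equation of `D` to an even tangential section `C`, given by `u = x(t)`, is
a square. -/
lemma EvenTangential.isSquare_eval {d : ℕ} {C D : Curve d} (h : EvenTangential C D) {x : ℂ[X]}
    {c : ℂ} (hc : c ≠ 0)
    (hC : affine C.eqn = Polynomial.C (Polynomial.C c) * (X - Polynomial.C x))
    (hD : (affine D.eqn).eval x ≠ 0) : IsSquare ((affine D.eqn).eval x) := by
  refine isSquare_of_even_rootMultiplicity fun τ => ?_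
  by_cases hτ : ((affine D.eqn).eval x).rootMultiplicity τ = 0
  · rw [hτ]; exact Even.zero
  · rw [← intersectionMult_graphPt (C := C) hc hC hD]
    refine (h.2 (graphPt x τ) ⟨?_, ?_⟩).2.2
    · change MvPolynomial.eval _ _ = 0
      rw [eval_graphPt, hC]; simp
    · change MvPolynomial.eval _ _ = 0
      rw [eval_graphPt]
      exact (rootMultiplicity_pos hD).1 (Nat.pos_of_ne_zero hτ)

/-! ### Splitting curves -/

section

variable {d : ℕ} {Γ : Curve d}

/-- A curve not contained in the branch locus splits if and only if the radicand is a square in its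
function field. -/
lemma isSplitting_iff_exists_sub_sq_mem {Z : DoubleCover} {h : Γ.localRing} {η : Z.field}
    (hroot : QuadraticExtension.IsSquarefreeRoot Γ.localRing h η)
    (hh : h ∉ IsLocalRing.maximalIdeal Γ.localRing) :
    Z.IsSplitting Γ ↔ ∃ w, h - w ^ 2 ∈ IsLocalRing.maximalIdeal Γ.localRing := by
  unfold DoubleCover.IsSplitting
  rw [Γ.ideal_eq_maximalIdeal]
  constructor
  · rintro ⟨P, Q, -, hP, hQ, hPQ, -, -, hmap⟩
    by_contra! hns
    exact hPQ ((hroot.eq_map_of_isPrime hns P (hmap ▸ Ideal.mul_le_left)).trans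
      (hroot.eq_map_of_isPrime hns Q (hmap ▸ Ideal.mul_le_right)).symm)
  · rintro ⟨w, hw⟩
    have hwu : IsUnit w := by
      by_contra hwu
      apply hh
      have := add_mem hw (Ideal.pow_mem_of_mem _ ((IsLocalRing.mem_maximalIdeal _).2 hwu) 2 two_pos)
      rwa [sub_add_cancel] at this
    obtain ⟨σ, τ, hσ, hτσ, hτ⟩ := hroot.exists_conj
    refine ⟨hroot.rootIdeal w, hroot.rootIdeal (-w), σ, (hroot.isMaximal_rootIdeal hw).isPrime,
      (hroot.isMaximal_rootIdeal_neg hw).isPrime, hroot.rootIdeal_ne hw hwu, hσ, ?_,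
      hroot.rootIdeal_mul hw hwu⟩
    intro x y hxy
    obtain rfl : y = τ x := Subtype.ext (hxy.trans (hτσ x).symm)
    exact hroot.map_rootIdeal_iff τ hτ w x

/-- The curve `Γ` with affine equation `F` splits in the double cover branched along `Δ₀ + Δ` if and only
if the affine equation of `Δ` is a square modulo `F`. -/
lemma isSplitting_iff_exists_dvd {Δ : Curve d} {F : ℂ[X][X]}
    (hF : ∀ (b : Cox) (k : ℕ × ℕ), IsHomog d b k → (Γ.eqn ∣ b ↔ F ∣ affine b))
    (hd : Even d) (hΔ : IsHomog d Δ.eqn (d, 1)) (hsq : Squarefree (MvPolynomial.X 3 * Δ.eqn))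
    (h0 : ¬ Γ.eqn ∣ MvPolynomial.X 0) (h3 : ¬ Γ.eqn ∣ MvPolynomial.X 3) (hΓΔ : ¬ Γ.eqn ∣ Δ.eqn)
    {Z : DoubleCover} (hZ : Z.IsSqrtOf (MvPolynomial.X 3 * Δ.eqn)) :
    Z.IsSplitting Γ ↔ ∃ a b : ℂ[X][X], ¬ F ∣ b ∧ F ∣ affine Δ.eqn * b ^ 2 - a ^ 2 := by
  obtain ⟨η, hη, hη2⟩ := hZ
  obtain ⟨m, rfl⟩ := hd
  have hp := Γ.irreducible.prime
  have hmem : ∀ x : Cox, x ∈ Γ.prime ↔ Γ.eqn ∣ x := fun x => Ideal.mem_span_singleton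
  set H := MvPolynomial.X 3 * Δ.eqn with hHdef
  have hH : IsHomog (m + m) H ((m, 1) + (m, 1)) := by
    convert (isHomog_X (m + m) 3).mul hΔ using 1
    ext <;> simp [weight]
  -- `H = v Δ` has the same class as `e²`, and `H / e²` is the affine equation of `Δ`
  set e : Cox := MvPolynomial.X 0 ^ m * MvPolynomial.X 3 with hedef
  have he : IsHomog (m + m) e (m, 1) := by
    convert ((isHomog_X (m + m) 0).pow m).mul (isHomog_X (m + m) 3) using 1
    ext <;> simp [weight]
  have he' : e ∉ Γ.prime := by
    rw [hmem]
    exact fun h => (hp.dvd_or_dvd h).elim (fun h => h0 (hp.dvd_of_dvd_pow h)) h3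
  have h1 : (1 : Cox) ∉ Γ.prime := by
    rw [hmem]; exact fun h => hp.not_isUnit (isUnit_of_dvd_one h)
  have hHp : H ∉ Γ.prime := by
    rw [hmem]; exact fun h => (hp.dvd_or_dvd h).elim h3 hΓΔ
  obtain ⟨h, hh, hhm, hroot⟩ := isSquarefreeRoot (𝔭 := Γ.prime) hη hη2 hH hsq he
    (MvPolynomial.isWeightedHomogeneous_one ℂ _) (add_zero _).symm he' h1
  rw [isSplitting_iff_exists_sub_sq_mem hroot (mt hhm.1 hHp)]
  have he0 := dehom_ne_zero he (ne_zero_of_notMem he')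
  have haffe : affine e = 1 := by simp [hedef]
  have haffH : affine H = affine Δ.eqn := by simp [hHdef]
  have key : ∀ (w : Γ.localRing) (n : ℕ × ℕ) (a b : Cox), IsHomog (m + m) a n →
      IsHomog (m + m) b n → b ∉ Γ.prime → (w : FunField) * dehom b = dehom a →
      (h - w ^ 2 ∈ IsLocalRing.maximalIdeal Γ.localRing ↔
        F ∣ affine Δ.eqn * affine b ^ 2 - affine a ^ 2) := by
    intro w n a b ha hb hb' hw
    have hnum : IsHomog (m + m) (H * (b * b) - a * a * (e * e)) ((m, 1) + (m, 1) + (n + n)) := by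
      refine (hH.mul (hb.mul hb)).sub ?_
      rw [add_comm _ (n + n)]
      exact (ha.mul ha).mul (he.mul he)
    rw [IsLocalRing.mem_maximalIdeal, mem_nonunits_iff, isUnit_localRing_iff (h - w ^ 2) hnum
      ((he.mul he).mul (hb.mul hb)), not_not, hmem, hF _ _ hnum]
    · simp only [map_sub, map_mul, haffe, haffH, mul_one, sq]
    · have hprime : Γ.prime.IsPrime := inferInstance
      exact fun hc => (hprime.mem_or_mem hc).elim
        (fun hc => (hprime.mem_or_mem hc).elim he' he')
        fun hc => (hprime.mem_or_mem hc).elim hb' hb'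
    · push_cast
      rw [hh]
      simp only [map_sub, map_mul, map_one, ← hw]
      field_simp
  constructor
  · rintro ⟨w, hw⟩
    obtain ⟨n, a, b, ha, hb, hb', hwab⟩ := w.2
    exact ⟨affine a, affine b, by rwa [← hF b n hb, ← hmem], (key w n a b ha hb hb' hwab).1 hw⟩
  · rintro ⟨a, b, hb, hab⟩
    obtain ⟨n, A, B, hA, hB, rfl, rfl⟩ := exists_homogenization₂ (m + m) a b
    have hB' : B ∉ Γ.prime := by rwa [hmem, hF B n hB]
    have hB0 := dehom_ne_zero hB (ne_zero_of_notMem hB')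
    exact ⟨⟨dehom A / dehom B, div_mem_localRing hA hB hB'⟩,
      (key _ n A B hA hB hB' (div_mul_cancel₀ _ hB0)).2 hab⟩

end

/-- Up to a non-zero constant, `u - x` is the square of a fraction `a / b` modulo `F` if and only if
`x - u` is the square of a polynomial over `ℂ(t)`: constants, among them `-1`, are squares, and over
`ℂ(t)` the denominator is invertible modulo `F`. -/
lemma exists_dvd_iff_exists_map_dvd {F : ℂ[X][X]} (hF : F.Monic) (hdeg : F.natDegree ≠ 0)
    (hirr : Irreducible (F.map (algebraMap ℂ[X] (RatFunc ℂ)))) {x : ℂ[X]} {c : ℂ} (hc : c ≠ 0) :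
    (∃ a b : ℂ[X][X], ¬ F ∣ b ∧ F ∣ C (C c) * (X - C x) * b ^ 2 - a ^ 2) ↔
      ∃ A : (RatFunc ℂ)[X], F.map (algebraMap ℂ[X] (RatFunc ℂ)) ∣
        A ^ 2 - (C (algebraMap ℂ[X] (RatFunc ℂ) x) - X) := by
  have hinj : Function.Injective (algebraMap ℂ[X] (RatFunc ℂ)) := RatFunc.algebraMap_injective ℂ
  -- `β² = -c` turns `c (u - x)` into `β² (x - u)`
  obtain ⟨β, hβ⟩ := IsAlgClosed.exists_pow_nat_eq (-c) two_pos
  have hβ0 : β ≠ 0 := by rintro rfl; exact hc (by simpa using hβ.symm)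
  have hcβ : c = -β ^ 2 := by rw [hβ, neg_neg]
  constructor
  · rintro ⟨a, b, hb, hab⟩
    rw [← map_dvd_map _ hinj hF] at hb hab
    obtain ⟨u, v, huv⟩ := hirr.coprime_iff_not_dvd.2 hb
    obtain ⟨g, hg⟩ := hab
    have hββ : (C (algebraMap ℂ[X] (RatFunc ℂ) (C β⁻¹)) : (RatFunc ℂ)[X]) *
        C (algebraMap ℂ[X] (RatFunc ℂ) (C β)) = 1 := by
      rw [← C_mul, ← map_mul, ← C_mul, inv_mul_cancel₀ hβ0, C_1, map_one, C_1]
    set b' := b.map (algebraMap ℂ[X] (RatFunc ℂ))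
    set a' := a.map (algebraMap ℂ[X] (RatFunc ℂ))
    set F' := F.map (algebraMap ℂ[X] (RatFunc ℂ))
    set B : (RatFunc ℂ)[X] := C (algebraMap ℂ[X] (RatFunc ℂ) (C β))
    set B' : (RatFunc ℂ)[X] := C (algebraMap ℂ[X] (RatFunc ℂ) (C β⁻¹))
    set x' : (RatFunc ℂ)[X] := C (algebraMap ℂ[X] (RatFunc ℂ) x) with hx'
    have hg' : -B ^ 2 * (X - x') * b' ^ 2 - a' ^ 2 = F' * g := by
      rw [← hg, hcβ]
      simp only [Polynomial.map_sub, Polynomial.map_mul, Polynomial.map_pow, map_C, map_X,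
        Polynomial.map_neg, _root_.map_neg, map_pow, a', b', B, x']
    refine ⟨B' * v * a', -B' ^ 2 * v ^ 2 * g - (x' - X) * u * (1 + v * b'), ?_⟩
    linear_combination (-B' ^ 2 * v ^ 2) * hg' + (x' - X) * (1 + v * b') * huv +
      (x' - X) * (v * b') ^ 2 * (1 + B' * B) * hββ
  · rintro ⟨A, hA⟩
    obtain ⟨e, heM, he⟩ := IsLocalization.integerNormalization_spec (nonZeroDivisors ℂ[X]) A
    have he0 : e ≠ 0 := nonZeroDivisors.ne_zero heM
    set a := IsLocalization.integerNormalization (nonZeroDivisors ℂ[X]) A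
    have he' : a.map (algebraMap ℂ[X] (RatFunc ℂ)) = C (algebraMap ℂ[X] (RatFunc ℂ) e) * A := by
      rw [he, ← algebraMap_smul (RatFunc ℂ) e A, smul_eq_C_mul]
    refine ⟨C (C β) * a, C e, fun h => ?_, ?_⟩
    · have := natDegree_le_of_dvd h (C_ne_zero.2 he0)
      rw [natDegree_C] at this
      omega
    · rw [← map_dvd_map _ hinj hF]
      obtain ⟨g, hg⟩ := hA
      refine ⟨-(C (algebraMap ℂ[X] (RatFunc ℂ) (C β * e))) ^ 2 * g, ?_⟩
      simp only [Polynomial.map_sub, Polynomial.map_mul, Polynomial.map_pow, map_C, map_X,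
        Polynomial.map_neg, _root_.map_neg, hcβ, he', map_mul,
        map_pow]
      linear_combination -(C (algebraMap ℂ[X] (RatFunc ℂ) (C β))) ^ 2 *
        (C (algebraMap ℂ[X] (RatFunc ℂ) e)) ^ 2 * hg

/-! ### The sections over an even tangential section -/

lemma aeval_ratFunc_eq (x : RatFunc ℂ) (a : Cox) :
    MvPolynomial.aeval ![1, RatFunc.X, x, 1] a =
      ((affine a).map (algebraMap ℂ[X] (RatFunc ℂ))).eval x := by
  induction a using MvPolynomial.induction_on with
  | C r =>
    rw [← MvPolynomial.algebraMap_eq, AlgHom.commutes, AlgHom.commutes]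
    simp [Polynomial.algebraMap_apply]
  | add p q hp hq => simp only [map_add, Polynomial.map_add, eval_add, hp, hq]
  | mul_X p i hp =>
    rw [map_mul, map_mul, hp, Polynomial.map_mul, eval_mul]
    congr 1
    fin_cases i <;> simp

lemma cubicPoly_genericFibre {d : ℕ} {Γ : Curve d} {a : ℂ} {F : ℂ[X][X]} (ha : a ≠ 0)
    (hF : F.Monic) (hdeg : F.natDegree = 3) (haF : affine Γ.eqn = C (C a) * F) :
    (genericFibre Γ).toAffine.cubicPoly = F.map (algebraMap ℂ[X] (RatFunc ℂ)) := by
  have h3 : F.coeff 3 = 1 := by rw [← hdeg]; exact hF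
  conv_rhs => rw [F.as_sum_range_C_mul_X_pow, hdeg]
  simp only [WeierstrassCurve.Affine.cubicPoly, genericFibre, WeierstrassCurve.toAffine,
    monicCoeff_eq ha hF hdeg haF, Finset.sum_range_succ, Finset.sum_range_zero, h3,
    Polynomial.map_add, Polynomial.map_mul, Polynomial.map_pow, map_C, map_X,
    Polynomial.map_one, Polynomial.map_zero, map_one]
  ring

end Hirzebruch

end

open Hirzebruch

theorem theorem1p2 (d : ℕ) (hd_pos : 0 < d) (hd_even : Even d)
    (Γ : Hirzebruch.Curve d)
    (hΓ_cls : Γ.cls = 3 • ((Hirzebruch.negSection d).cls + d • Hirzebruch.fibreClass))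
    (hΓ_sing : Γ.AtWorstSimpleSingularities)
    (Δ : Hirzebruch.Curve d) (hΔ_section : Δ.IsSection)
    (hΔ_cls : Δ.cls = (Hirzebruch.negSection d).cls + d • Hirzebruch.fibreClass)
    (hΔ_even : Hirzebruch.EvenTangential Δ Γ) :
    -- the double cover with branch locus `Δ₀ + Γ`, its generic fibre over `ℙ¹`
    (Hirzebruch.HasUniqueDoubleCover d ((Hirzebruch.negSection d).points ∪ Γ.points) ∧
      ∀ S : Hirzebruch.DoubleCover,
        S.branchLocus d = (Hirzebruch.negSection d).points ∪ Γ.points →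
          S.HasGenericFibre (Hirzebruch.genericFibre Γ)) ∧
    -- the double cover with branch locus `Δ₀ + Δ`
    Hirzebruch.HasUniqueDoubleCover d ((Hirzebruch.negSection d).points ∪ Δ.points) ∧
    -- the two sections over `Δ`, and the reciprocity
    ∃ sPlus sMinus : Hirzebruch.MW Γ,
      Hirzebruch.sectionsOver Γ Δ = {sPlus, sMinus} ∧ sPlus ≠ sMinus ∧ sPlus = -sMinus ∧
      Hirzebruch.residueSymbol ((Hirzebruch.negSection d).points ∪ Δ.points) Γ =
        (-1) ^ Hirzebruch.eps sPlus ∧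
      Hirzebruch.eps sPlus = Hirzebruch.eps sMinus := by
  have hΓ : Γ.cls = (3 * d, 3) := by
    rw [hΓ_cls]; ext <;> simp [negSection, fibreClass]
  have hΔ : Δ.cls = (1 * d, 1) := by
    rw [hΔ_cls]; ext <;> simp [negSection, fibreClass]
  have h3 : 0 < 3 := by norm_num
  obtain ⟨m, hm⟩ := hd_even
  -- the classes of `Δ₀ + Γ` and `Δ₀ + Δ` are even
  have hHΓ : IsHomog d (MvPolynomial.X 3 * Γ.eqn) ((3 * m, 2) + (3 * m, 2)) := by
    convert (isHomog_X d 3).mul Γ.homogeneous using 1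
    rw [hΓ]; ext <;> simp [weight]
    omega
  have hHΔ : IsHomog d (MvPolynomial.X 3 * Δ.eqn) ((m, 1) + (m, 1)) := by
    convert (isHomog_X d 3).mul Δ.homogeneous using 1
    rw [hΔ]; ext <;> simp [weight]
    omega
  have hsqΓ := Curve.squarefree_X_mul hd_pos h3 hΓ
  have hsqΔ := Curve.squarefree_X_mul hd_pos one_pos hΔ
  obtain ⟨a, F, ha, hF, hdeg, hFp, haF, hdvd⟩ := Curve.exists_monic hd_pos h3 hΓ
  obtain ⟨b, G, hb, hG, hdegG, -, hbG, -⟩ := Curve.exists_monic hd_pos one_pos hΔ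
  obtain ⟨x, rfl⟩ : ∃ x, G = X - C x := ⟨-G.coeff 0, by
    rw [map_neg, sub_neg_eq_add]; exact hG.eq_X_add_C hdegG⟩
  have hcub := cubicPoly_genericFibre ha hF hdeg haF
  have hirr : Irreducible (F.map (algebraMap ℂ[X] (RatFunc ℂ))) :=
    (hF.irreducible_iff_irreducible_map_fraction_map).1 hFp.irreducible
  have hirr' : Irreducible (genericFibre Γ).toAffine.cubicPoly := hcub ▸ hirr
  have ha₁ : (genericFibre Γ).toAffine.a₁ = 0 := rfl
  have ha₃ : (genericFibre Γ).toAffine.a₃ = 0 := rfl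
  set xK := algebraMap ℂ[X] (RatFunc ℂ) x with hxK
  have heval : (genericFibre Γ).toAffine.cubicPoly.eval xK =
      algebraMap ℂ[X] (RatFunc ℂ) (F.eval x) := by
    rw [hcub, hxK, eval_map, eval₂_at_apply]
  have hF0 : F.eval x ≠ 0 := by
    intro h0
    rw [h0, map_zero] at heval
    exact WeierstrassCurve.Affine.eval_cubicPoly_ne_zero hirr' xK heval
  -- `x` is the first coordinate of a rational point
  obtain ⟨y, hy⟩ : ∃ y : RatFunc ℂ, y ^ 2 = (genericFibre Γ).toAffine.cubicPoly.eval xK := by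
    have hne : (affine Γ.eqn).eval x ≠ 0 := by
      rw [haF, eval_mul, eval_C]; exact mul_ne_zero (C_ne_zero.2 ha) hF0
    obtain ⟨r, hr⟩ := hΔ_even.isSquare_eval hb hbG hne
    obtain ⟨z, hz⟩ := IsAlgClosed.exists_pow_nat_eq a two_pos
    have hz0 : z ≠ 0 := by rintro rfl; exact ha (by rw [← hz]; simp)
    refine ⟨algebraMap ℂ[X] (RatFunc ℂ) (C z⁻¹ * r), ?_⟩
    rw [heval, ← map_pow]
    congr 1
    rw [haF, eval_mul, eval_C] at hr
    rw [mul_pow, sq r, ← hr, ← mul_assoc, ← C_pow, ← C_mul, inv_pow, hz, inv_mul_cancel₀ ha, C_1,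
      one_mul]
  have hy0 : y ≠ 0 := by
    rintro rfl
    exact WeierstrassCurve.Affine.eval_cubicPoly_ne_zero hirr' xK (by rw [← hy]; ring)
  have hns : (genericFibre Γ).toAffine.Nonsingular xK y :=
    WeierstrassCurve.Affine.nonsingular_of_ne_zero ha₁ ha₃ hy hy0
  have hns' : (genericFibre Γ).toAffine.Nonsingular xK (-y) :=
    WeierstrassCurve.Affine.nonsingular_of_ne_zero ha₁ ha₃ (by rw [neg_sq, hy])
      (neg_ne_zero.2 hy0)
  have hover : ∀ z : RatFunc ℂ,
      MvPolynomial.aeval ![1, RatFunc.X, z, 1] Δ.eqn = 0 ↔ z = xK := by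
    intro z
    have hbK : algebraMap ℂ[X] (RatFunc ℂ) (C b) ≠ 0 := by simpa using hb
    rw [aeval_ratFunc_eq, hbG]
    simp only [Polynomial.map_mul, Polynomial.map_sub, map_C, map_X, eval_mul, eval_sub, eval_C,
      eval_X, mul_eq_zero, hbK, false_or, sub_eq_zero]
    rfl
  -- the criterion for divisibility by `2`
  have hε : ∀ (y : RatFunc ℂ) (hy : (genericFibre Γ).toAffine.Nonsingular xK y),
      eps (.some xK y hy : MW Γ) = 0 ↔ ∃ A : (RatFunc ℂ)[X],
        F.map (algebraMap ℂ[X] (RatFunc ℂ)) ∣ A ^ 2 - (C xK - X) := by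
    classical
    intro y hy
    rw [← hcub, ← WeierstrassCurve.Affine.exists_eq_two_nsmul_iff ha₁ ha₃ hirr' hy]
    unfold eps
    split_ifs with h
    · exact iff_of_true rfl (by convert h)
    · exact iff_of_false not_false (by convert h)
  have hε01 : ∀ s : MW Γ, eps s = 0 ∨ eps s = 1 := fun s => by
    unfold eps; split_ifs <;> simp
  have hp := Γ.irreducible.prime
  have hΓX : ∀ i, (weight d i = (1, 0) ∨ weight d i = (0, 1)) → ¬ Γ.eqn ∣ MvPolynomial.X i :=
    fun i hi h => Curve.not_associated_X hd_pos h3 hΓ hi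
      (Γ.irreducible.associated_of_dvd MvPolynomial.X_prime.irreducible h)
  -- the same criterion for splitting
  have hsplit : ∀ Z : DoubleCover, Z.IsSqrtOf (MvPolynomial.X 3 * Δ.eqn) →
      (Z.IsSplitting Γ ↔ ∃ A : (RatFunc ℂ)[X],
        F.map (algebraMap ℂ[X] (RatFunc ℂ)) ∣ A ^ 2 - (C xK - X)) := by
    intro Z hZ
    rw [isSplitting_iff_exists_dvd hdvd ⟨m, hm⟩ (by
      have := Δ.homogeneous
      rwa [hΔ, one_mul] at this) hsqΔ (hΓX 0 (Or.inl rfl)) (hΓX 3 (Or.inr rfl))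
      (fun h => hΔ_even.1 (Γ.irreducible.associated_of_dvd Δ.irreducible h).symm) hZ, hbG]
    exact exists_dvd_iff_exists_map_dvd hF (by omega) hirr hb
  simp only [negSection_points_union]
  have huniq := hasUniqueDoubleCover hHΔ hsqΔ (not_isUnit_X_mul _)
  refine ⟨⟨hasUniqueDoubleCover hHΓ hsqΓ (not_isUnit_X_mul _), fun S hS =>
    hasGenericFibre ha hF hdeg haF ((S.branchLocus_eq_iff hHΓ hsqΓ).1 hS)⟩, huniq,
    .some xK y hns, .some xK (-y) hns', ?_, ?_, ?_, ?_, ?_⟩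
  · ext s
    simp only [sectionsOver, Set.mem_ofPred_eq, Set.mem_insert_iff, Set.mem_singleton_iff]
    constructor
    · rintro ⟨x', y', h', rfl, hx'⟩
      obtain rfl := (hover x').1 hx'
      have h1 := (WeierstrassCurve.Affine.equation_iff_eval_cubicPoly ha₁ ha₃ _ _).1 h'.1
      rw [← hy] at h1
      rcases sq_eq_sq_iff_eq_or_eq_neg.1 h1 with rfl | rfl
      · exact Or.inl rfl
      · exact Or.inr rfl
    · rintro (rfl | rfl)
      · exact ⟨xK, y, hns, rfl, (hover xK).2 rfl⟩
      · exact ⟨xK, -y, hns', rfl, (hover xK).2 rfl⟩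
  · intro h
    rw [WeierstrassCurve.Affine.Point.some.injEq] at h
    exact hy0 (self_eq_neg.1 h.2)
  · rw [WeierstrassCurve.Affine.Point.neg_some, WeierstrassCurve.Affine.Point.some.injEq]
    refine ⟨rfl, ?_⟩
    rw [WeierstrassCurve.Affine.negY_eq_neg ha₁ ha₃, neg_neg]
  · have hres : IsQuadraticResidue
        {p : Pt | MvPolynomial.eval p.coord (MvPolynomial.X 3 * Δ.eqn) = 0} Γ ↔
        eps (.some xK y hns : MW Γ) = 0 := by
      rw [hε]
      constructor
      · rintro ⟨Z, hZ, -, hs⟩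
        exact (hsplit Z ((Z.branchLocus_eq_iff hHΔ hsqΔ).1 hZ)).1 hs
      · intro hA
        obtain ⟨Z, hZ, hZu⟩ := huniq
        exact ⟨Z, hZ, hZu, (hsplit Z ((Z.branchLocus_eq_iff hHΔ hsqΔ).1 hZ)).2 hA⟩
    unfold residueSymbol
    rcases hε01 (.some xK y hns) with h0 | h1
    · rw [if_pos (hres.2 h0), h0, pow_zero]
    · rw [if_neg fun h => by rw [hres.1 h] at h1; exact zero_ne_one h1, h1, pow_one]
  · have h1 := (hε y hns).trans (hε (-y) hns').symm
    rcases hε01 (.some xK y hns) with h2 | h2 <;> rcases hε01 (.some xK (-y) hns') with h3 | h3 <;>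
      simp_all
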